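/- Let $k\ge 1$ and $n\ge 2k$ be integers. There are $k$ identical units for sale to $n$ unit-demand bidders with independent private values. A (direct) mechanism consists of an allocation $x$ and a payment rule $p$, where for every bid profile $b\in[0,\infty)^n$, $x_i(b)\in[0,1]$ is the probability that bidder $i$ gets a unit, $\sum_i x_i(b)\le k$, and $p_i(b)$ is bidder $i$'s expected payment. It is Bayesian incentive compatible (BIC) with respect to a product distribution $\mathbf D=D_1\times\dots\times D_n$ if for every bidder and every value of hers, when the other bidders bid truthfully, truthful bidding maximizes her expected utility and gives her nonnegative expected utility. $\mathrm{Rev}(M,\mathbf D)$ is the expected total payment of $M$ under truthful bidding with values drawn from $\mathbf D$, and $\mathrm{Opt}(\mathbf D)$ is the optimal revenue, i.e. the supremum of $\mathrm{Rev}(M,\mathbf D)$ over all mechanisms $M$ that are BIC with respect to $\mathbf D$. For $0<\varepsilon<k$ let $D^b$ be the point mass at $\tfrac12$, and let $D^h$, $D^\ell$ be the distributions supported on $v_3=\tfrac12+\tfrac{k}{8n}$, $v_2=\tfrac34$, $v_1=1$ with $$D^h(v_3)=1-\tfrac{k}{2n},\quad D^h(v_2)=\tfrac{k+\varepsilon}{4n},\quad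 D^h(v_1)=\tfrac{k-\varepsilon}{4n};\qquad D^\ell(v_3)=1-\tfrac{k}{2n},\quad D^\ell(v_2)=\tfrac{k-\varepsilon}{4n},\quad D^\ell(v_1)=\tfrac{k+\varepsilon}{4n}.$$ Let $\mathcal H=\mathcal H_{n,k,\varepsilon}$ be the family of all product distributions $\mathbf D$ with $D_1=\dots=D_k=D^b$ and $D_i\in\{D^h,D^\ell\}$ for $k<i\le n$; all values lie in $[0,1]$. Theorem. There are absolute constants $c_0,c_1>0$ such that for all integers $k\ge1$, $n\ge 2k$ and all $0<\varepsilon<k$ the following holds. Suppose a (possibly randomized) algorithm takes $m$ i.i.d. samples from an unknown $\mathbf D$ and, for every $\mathbf D\in\mathcal H_{n,k,\varepsilon}$, returns with probability at least $0.99$ (over the samples and its internal randomness) a mechanism that is BIC with respect to $\mathbf D$ and whose expected revenue is at least $\mathrm{Opt}(\mathbf D)-c_0\,\varepsilon$. Then $$m\;\ge\; c_1\,\frac{nk}{\varepsilon^{2}}.$$ -/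

import Mathlib

open MeasureTheory

noncomputable section

/-- A direct revelation mechanism for selling `k` identical units to `n` unit-demand bidders.
For a bid profile `b`, `alloc b i` is the probability that bidder `i` gets a unit and `pay b i` is
the expected payment of bidder `i`. Bids are nonnegative reals. -/
structure Mechanism (n k : ℕ) where
  alloc : (Fin n → ℝ) → Fin n → ℝ
  pay : (Fin n → ℝ) → Fin n → ℝ
  measurable_alloc : ∀ i, Measurable fun b => alloc b i
  measurable_pay : ∀ i, Measurable fun b => pay b i
  alloc_nonneg : ∀ b, 0 ≤ b → ∀ i, 0 ≤ alloc b i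
  alloc_le_one : ∀ b, 0 ≤ b → ∀ i, alloc b i ≤ 1
  sum_alloc_le : ∀ b, 0 ≤ b → ∑ i, alloc b i ≤ k

/-- The joint law of the value profile when the values are independent and bidder `i`'s value has
law `D i`. -/
def valueLaw {n : ℕ} (D : Fin n → Measure ℝ) : Measure (Fin n → ℝ) :=
  Measure.pi D

/-- Expected utility of bidder `i` with value `t` who bids `b`, when all other bidders bid
truthfully and their values are drawn from `D`. (The coordinate `i` of `v` is overwritten by `b`,
and the values are independent.) -/
def interimUtility {n k : ℕ} (M : Mechanism n k) (D : Fin n → Measure ℝ) (i : Fin n)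
    (t b : ℝ) : ℝ :=
  ∫ v, (t * M.alloc (Function.update v i b) i - M.pay (Function.update v i b) i) ∂(valueLaw D)

/-- Bayesian incentive compatibility with respect to `D`: truthful bidding maximizes the expected
utility of every bidder at every value, and this utility is nonnegative. The integrability fields
say that the expected payments involved exist. -/
structure IsBIC {n k : ℕ} (M : Mechanism n k) (D : Fin n → Measure ℝ) : Prop where
  integrable_pay : ∀ i, Integrable (fun v => M.pay v i) (valueLaw D)
  integrable_pay_update : ∀ i (b : ℝ), 0 ≤ b →
    Integrable (fun v => M.pay (Function.update v i b) i) (valueLaw D)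
  truthful : ∀ i (t b : ℝ), 0 ≤ t → 0 ≤ b →
    interimUtility M D i t b ≤ interimUtility M D i t t
  rational : ∀ i (t : ℝ), 0 ≤ t → 0 ≤ interimUtility M D i t t

/-- Expected revenue of `M` under truthful bidding when values are drawn from `D`. -/
def revenue {n k : ℕ} (M : Mechanism n k) (D : Fin n → Measure ℝ) : ℝ :=
  ∫ v, ∑ i, M.pay v i ∂(valueLaw D)

/-- The optimal revenue: the supremum of the expected revenue over all `k`-unit mechanisms that are
Bayesian incentive compatible with respect to `D`. -/
def optRevenue {n : ℕ} (k : ℕ) (D : Fin n → Measure ℝ) : ℝ :=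
  sSup ((fun M : Mechanism n k => revenue M D) '' {M | IsBIC M D})

/-- `D^b`: the point mass at `1/2`. -/
def baseDist : Measure ℝ := Measure.dirac (1 / 2)

/-- `D^h`: mass `1 - k/(2n)` at `1/2 + k/(8n)`, mass `(k+ε)/(4n)` at `3/4`, and mass `(k-ε)/(4n)`
at `1`. -/
def highDist (n k : ℕ) (ε : ℝ) : Measure ℝ :=
  ENNReal.ofReal (1 - k / (2 * n)) • Measure.dirac (1 / 2 + k / (8 * n) : ℝ)
    + ENNReal.ofReal ((k + ε) / (4 * n)) • Measure.dirac (3 / 4 : ℝ)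
    + ENNReal.ofReal ((k - ε) / (4 * n)) • Measure.dirac (1 : ℝ)

/-- `D^ℓ`: mass `1 - k/(2n)` at `1/2 + k/(8n)`, mass `(k-ε)/(4n)` at `3/4`, and mass `(k+ε)/(4n)`
at `1`. -/
def lowDist (n k : ℕ) (ε : ℝ) : Measure ℝ :=
  ENNReal.ofReal (1 - k / (2 * n)) • Measure.dirac (1 / 2 + k / (8 * n) : ℝ)
    + ENNReal.ofReal ((k - ε) / (4 * n)) • Measure.dirac (3 / 4 : ℝ)
    + ENNReal.ofReal ((k + ε) / (4 * n)) • Measure.dirac (1 : ℝ)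

/-- The hard family: the first `k` bidders have law `D^b`, and each of the remaining `n - k`
bidders has law `D^h` or `D^ℓ`. -/
def hardFamily (n k : ℕ) (ε : ℝ) : Set (Fin n → Measure ℝ) :=
  {D | (∀ i : Fin n, (i : ℕ) < k → D i = baseDist) ∧
    ∀ i : Fin n, k ≤ (i : ℕ) → D i = highDist n k ε ∨ D i = lowDist n k ε}

/-- A (possibly randomized) learning algorithm: from `m` sampled value profiles and an internal
random seed in `Ω` it outputs a `k`-unit mechanism for `n` bidders. The output depends measurably
on the samples, the seed and the bids. -/
structure LearningAlgorithm (n k m : ℕ) (Ω : Type*) [MeasurableSpace Ω] where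
  out : (Fin m → Fin n → ℝ) → Ω → Mechanism n k
  measurable_alloc : ∀ i, Measurable
    fun q : ((Fin m → Fin n → ℝ) × Ω) × (Fin n → ℝ) => (out q.1.1 q.1.2).alloc q.2 i
  measurable_pay : ∀ i, Measurable
    fun q : ((Fin m → Fin n → ℝ) × Ω) × (Fin n → ℝ) => (out q.1.1 q.1.2).pay q.2 i

/-- The joint law of `m` i.i.d. samples from the product distribution `D` and an independent
internal seed of law `P`. -/
def runLaw {n : ℕ} (m : ℕ) (D : Fin n → Measure ℝ) {Ω : Type*} [MeasurableSpace Ω]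
    (P : Measure Ω) : Measure ((Fin m → Fin n → ℝ) × Ω) :=
  (Measure.pi fun _ : Fin m => valueLaw D).prod P

/-- The probability, over the `m` i.i.d. samples from `D` and the internal seed, that the algorithm
returns a mechanism that is Bayesian incentive compatible with respect to `D` and has expected
revenue at least the optimal revenue minus `η`. -/
def successProb {n k m : ℕ} {Ω : Type*} [MeasurableSpace Ω] (A : LearningAlgorithm n k m Ω)
    (P : Measure Ω) (D : Fin n → Measure ℝ) (η : ℝ) : ℝ :=
  (runLaw m D P).real
    {q | IsBIC (A.out q.1 q.2) D ∧ optRevenue k D - η ≤ revenue (A.out q.1 q.2) D}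

end

/-! The three-point law with perturbation `e` (`ε` for D^h, `-ε` for D^ℓ) has virtual value exactly
1/2 at 1/2 + k/(8n), 1/2 + e/(2(k+e)) at 3/4, and 1 at 1. The k base bidders always offer k sales at
1/2, so a bidder of value 3/4 deserves priority over them exactly when e > 0. Near-optimal revenue
therefore requires the signs of most of the n - k perturbations.

Loss: on average at most k/2 non-base bidders have value at least 3/4. By Markov, with probability
at least 1/2 at most k bidders are active once bidder i is placed at 3/4, and then she should be
served if e i > 0. An interim allocation at 3/4 on the wrong side of 1/4 thus costs at least (mass
of 3/4)·(excess virtual value)·1/4, that is |e i|/(32n). These losses add up over bidders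
(`IsBIC.revenue_add_loss_le`), so a mechanism within c₀ε of the optimum has at most 32c₀n wrong
bidders (`card_misallocates_le`).

Testing: the interim allocation of i does not involve the law of i, so comparing it with 1/4 is a
test of the sign of e i based on the samples. Flipping that sign moves the law of m samples by a
squared distance of order mε²/(nk). If this is small, the two error probabilities add up to at least
9/10 (`nine_tenths_le_flip_add`). Averaging over all sign vectors, as in Assouad's lemma, gives at
least (9/20)(n-k) ≥ 9n/40 expected errors, while success with probability 0.99 and c₀ = 1/640 allows
only n/20 + n/100. -/

/-! ### Product measures: resampling a coordinate, and densities. -/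

section ProductMeasures

/-- Used with `ν = D i` to condition on the value of bidder i, and with a Dirac mass for a fixed
bid. -/
theorem map_update_pi {ι : Type*} [Fintype ι] [DecidableEq ι] {X : ι → Type*}
    [∀ i, MeasurableSpace (X i)] (D : ∀ i, Measure (X i)) [∀ i, IsProbabilityMeasure (D i)]
    (i : ι) (ν : Measure (X i)) [IsProbabilityMeasure ν] :
    (ν.prod (Measure.pi D)).map (fun p => Function.update p.2 i p.1)
      = Measure.pi (Function.update D i ν) := by
  have : ∀ j, IsProbabilityMeasure (Function.update D i ν j) := by
    intro j
    by_cases h : j = i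
    · subst h; simpa using ‹IsProbabilityMeasure ν›
    · simpa [h] using (inferInstance : IsProbabilityMeasure (D j))
  have hmeas : Measurable fun p : X i × (∀ j, X j) => Function.update p.2 i p.1 :=
    measurable_update'.comp measurable_swap
  symm
  apply Measure.pi_eq
  intro s hs
  rw [Measure.map_apply hmeas (MeasurableSet.univ_pi hs)]
  have : (fun p : X i × (∀ j, X j) => Function.update p.2 i p.1) ⁻¹' (Set.univ.pi s)
      = s i ×ˢ (Set.univ.pi (Function.update s i Set.univ)) := by
    ext ⟨a, v⟩
    simp only [Set.mem_preimage, Set.mem_pi, Set.mem_univ, true_implies, Set.mem_prod]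
    constructor
    · intro h
      refine ⟨by simpa using h i, fun j => ?_⟩
      by_cases hj : j = i
      · subst hj; simp
      · simpa [hj] using h j
    · rintro ⟨h1, h2⟩ j
      by_cases hj : j = i
      · subst hj; simpa using h1
      · simpa [hj] using h2 j
  rw [this, Measure.prod_prod, Measure.pi_pi, ← Finset.mul_prod_erase _ _ (Finset.mem_univ i),
    ← Finset.mul_prod_erase Finset.univ (fun j => (Function.update D i ν j) (s j))
      (Finset.mem_univ i)]
  simp only [Function.update_self, measure_univ, one_mul]
  congr 1
  refine Finset.prod_congr rfl fun j hj => ?_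
  simp [(Finset.mem_erase.1 hj).1]

theorem measurable_update_const {ι : Type*} [DecidableEq ι] {X : ι → Type*}
    [∀ i, MeasurableSpace (X i)] (i : ι) (s : X i) :
    Measurable fun v : ∀ j, X j => Function.update v i s :=
  measurable_update'.comp measurable_prodMk_right

theorem map_update_const_pi {ι : Type*} [Fintype ι] [DecidableEq ι] {X : ι → Type*}
    [∀ i, MeasurableSpace (X i)] (D : ∀ i, Measure (X i)) [∀ i, IsProbabilityMeasure (D i)]
    (i : ι) (s : X i) :
    (Measure.pi D).map (fun v => Function.update v i s)
      = Measure.pi (Function.update D i (Measure.dirac s)) := by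
  rw [← map_update_pi D i (Measure.dirac s), Measure.dirac_prod, Measure.map_map]
  · rfl
  · exact measurable_update'.comp measurable_swap
  · exact measurable_prodMk_left

theorem integral_pi_eq_integral_update {ι : Type*} [Fintype ι] [DecidableEq ι] {X : ι → Type*}
    [∀ i, MeasurableSpace (X i)] (D : ∀ i, Measure (X i)) [∀ i, IsProbabilityMeasure (D i)]
    (i : ι) {f : (∀ j, X j) → ℝ} (hf : Integrable f (Measure.pi D)) :
    ∫ v, f v ∂(Measure.pi D) = ∫ s, ∫ v, f (Function.update v i s) ∂(Measure.pi D) ∂(D i) := by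
  have h := map_update_pi D i (D i)
  rw [Function.update_eq_self] at h
  have hm : Measurable fun p : X i × (∀ j, X j) => Function.update p.2 i p.1 :=
    measurable_update'.comp measurable_swap
  have hf' : Integrable f (((D i).prod (Measure.pi D)).map
      fun p => Function.update p.2 i p.1) := by rwa [h]
  conv_lhs => rw [← h]
  rw [integral_map hm.aemeasurable hf'.aestronglyMeasurable]
  exact integral_prod _ (hf'.comp_measurable hm)

theorem pi_withDensity {ι : Type*} [Fintype ι] {X : ι → Type*}
    [∀ i, MeasurableSpace (X i)] (μ : ∀ i, Measure (X i)) [∀ i, IsProbabilityMeasure (μ i)]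
    (f : ∀ i, X i → ENNReal) (hf : ∀ i, Measurable (f i))
    [∀ i, IsProbabilityMeasure ((μ i).withDensity (f i))] :
    Measure.pi (fun i => (μ i).withDensity (f i))
      = (Measure.pi μ).withDensity fun x => ∏ i, f i (x i) := by
  apply Measure.pi_eq
  intro s hs
  rw [withDensity_apply _ (MeasurableSet.univ_pi hs),
    ← lintegral_indicator (MeasurableSet.univ_pi hs)]
  have h1 : (Set.univ.pi s).indicator (fun x : ∀ i, X i => ∏ i, f i (x i))
      = fun x => ∏ i, (s i).indicator (f i) (x i) := by
    ext x
    by_cases hx : x ∈ Set.univ.pi s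
    · rw [Set.indicator_of_mem hx]
      exact Finset.prod_congr rfl fun i _ => (Set.indicator_of_mem (hx i trivial) _).symm
    · rw [Set.indicator_of_notMem hx]
      have : ∃ i, x i ∉ s i := by simpa [Set.mem_pi] using hx
      obtain ⟨i, hi⟩ := this
      exact (Finset.prod_eq_zero (Finset.mem_univ i) (Set.indicator_of_notMem hi _)).symm
  have hm : ∀ i, Measurable ((s i).indicator (f i)) := fun i => (hf i).indicator (hs i)
  have h2 := ProbabilityTheory.lintegral_prod_eq_prod_lintegral_of_indepFun (μ := Measure.pi μ)
    Finset.univ (fun i (x : ∀ i, X i) => (s i).indicator (f i) (x i))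
    (ProbabilityTheory.iIndepFun_pi (fun i => (hm i).aemeasurable))
    (fun i => (hm i).comp (measurable_pi_apply i))
  rw [h1, h2]
  refine Finset.prod_congr rfl fun i _ => ?_
  rw [withDensity_apply _ (hs i), ← lintegral_indicator (hs i)]
  exact (measurePreserving_eval μ i).lintegral_comp (hm i)

end ProductMeasures

/-! ### The three-point laws and their densities relative to the unperturbed law. -/

section ThreePointLaws

theorem lowDist_eq_highDist_neg (n k : ℕ) (ε : ℝ) : lowDist n k ε = highDist n k (-ε) := by
  simp [lowDist, highDist, sub_eq_add_neg]

theorem isProbabilityMeasure_highDist {n k : ℕ} (hk : 1 ≤ k) (hn : 2 * k ≤ n) {e : ℝ}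
    (he : |e| ≤ k) : IsProbabilityMeasure (highDist n k e) := by
  have hk' : (1 : ℝ) ≤ k := by exact_mod_cast hk
  have hn' : 2 * (k : ℝ) ≤ n := by exact_mod_cast hn
  obtain ⟨h1, h2⟩ := abs_le.1 he
  have hn0 : (0 : ℝ) < n := by linarith
  constructor
  have h3 : (0 : ℝ) ≤ 1 - k / (2 * n) := by
    rw [sub_nonneg, div_le_one (by linarith)]; linarith
  have h4 : (0 : ℝ) ≤ (k + e) / (4 * n) := div_nonneg (by linarith) (by linarith)
  have h5 : (0 : ℝ) ≤ (k - e) / (4 * n) := div_nonneg (by linarith) (by linarith)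
  simp only [highDist, Measure.coe_add, Measure.coe_smul, Pi.add_apply, Pi.smul_apply,
    measure_univ, smul_eq_mul, mul_one]
  rw [← ENNReal.ofReal_add h3 h4, ← ENNReal.ofReal_add (add_nonneg h3 h4) h5,
    ← ENNReal.ofReal_one]
  congr 1
  field_simp
  ring

theorem integral_highDist {n k : ℕ} (hk : 1 ≤ k) (hn : 2 * k ≤ n) {e : ℝ}
    (he : |e| ≤ k) (f : ℝ → ℝ) :
    ∫ x, f x ∂(highDist n k e) = (1 - k / (2 * n)) * f (1 / 2 + k / (8 * n))
      + (k + e) / (4 * n) * f (3 / 4) + (k - e) / (4 * n) * f 1 := by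
  have hk' : (1 : ℝ) ≤ k := by exact_mod_cast hk
  have hn' : 2 * (k : ℝ) ≤ n := by exact_mod_cast hn
  obtain ⟨h1, h2⟩ := abs_le.1 he
  have h3 : (0 : ℝ) ≤ 1 - k / (2 * n) := by
    rw [sub_nonneg, div_le_one (by linarith)]; linarith
  have h4 : (0 : ℝ) ≤ (k + e) / (4 * n) := div_nonneg (by linarith) (by linarith)
  have h5 : (0 : ℝ) ≤ (k - e) / (4 * n) := div_nonneg (by linarith) (by linarith)
  have hi : ∀ (c a : ℝ), Integrable f (ENNReal.ofReal c • Measure.dirac a) := fun c a =>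
    (integrable_dirac (by simp)).smul_measure ENNReal.ofReal_ne_top
  rw [highDist, integral_add_measure ((hi _ _).add_measure (hi _ _)) (hi _ _),
    integral_add_measure (hi _ _) (hi _ _)]
  simp [integral_smul_measure, h3, h4, h5]

theorem ae_highDist_iff {n k : ℕ} {e : ℝ} {p : ℝ → Prop} (h3 : p (1 / 2 + k / (8 * n)))
    (h2 : p (3 / 4)) (h1 : p 1) : ∀ᵐ x ∂(highDist n k e), p x := by
  have hi : ∀ (c a : ℝ), p a → ∀ᵐ x ∂(ENNReal.ofReal c • Measure.dirac a), p x := fun c a ha =>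
    Measure.ae_smul_measure (by rw [ae_dirac_eq]; exact ha) _
  rw [highDist, ae_add_measure_iff, ae_add_measure_iff]
  exact ⟨⟨hi _ _ h3, hi _ _ h2⟩, hi _ _ h1⟩

/-- The density of `highDist n k e` with respect to `highDist n k 0`. -/
noncomputable def tiltDensity (k : ℕ) (e : ℝ) (v : ℝ) : ℝ :=
  if v = 3 / 4 then 1 + e / k else if v = 1 then 1 - e / k else 1

theorem measurable_tiltDensity (k : ℕ) (e : ℝ) : Measurable (tiltDensity k e) :=
  Measurable.ite (measurableSet_singleton _) measurable_const
    (Measurable.ite (measurableSet_singleton _) measurable_const measurable_const)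

theorem tiltDensity_nonneg {k : ℕ} (hk : 1 ≤ k) {e : ℝ} (he : |e| ≤ k) (v : ℝ) :
    0 ≤ tiltDensity k e v := by
  have hk' : (0 : ℝ) < k := by exact_mod_cast hk
  obtain ⟨h1, h2⟩ := abs_le.1 he
  have h3 : e / k ≤ 1 := (div_le_one hk').2 h2
  have h4 : -1 ≤ e / k := by rw [le_div_iff₀ hk']; linarith
  unfold tiltDensity
  split_ifs <;> linarith

theorem tiltDensity_le_two {k : ℕ} (hk : 1 ≤ k) {e : ℝ} (he : |e| ≤ k) (v : ℝ) :
    tiltDensity k e v ≤ 2 := by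
  have hk' : (0 : ℝ) < k := by exact_mod_cast hk
  obtain ⟨h1, h2⟩ := abs_le.1 he
  have h3 : e / k ≤ 1 := (div_le_one hk').2 h2
  have h4 : -1 ≤ e / k := by rw [le_div_iff₀ hk']; linarith
  unfold tiltDensity
  split_ifs <;> linarith

theorem lowValue_lt {n k : ℕ} (hk : 1 ≤ k) (hn : 2 * k ≤ n) :
    (1 / 2 + k / (8 * n) : ℝ) < 3 / 4 := by
  have hk' : (1 : ℝ) ≤ k := by exact_mod_cast hk
  have hn' : 2 * (k : ℝ) ≤ n := by exact_mod_cast hn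
  have : (k / (8 * n) : ℝ) < 1 / 4 := by rw [div_lt_iff₀ (by linarith)]; linarith
  linarith

theorem tiltDensity_lowValue {n k : ℕ} (hk : 1 ≤ k) (hn : 2 * k ≤ n) (e : ℝ) :
    tiltDensity k e (1 / 2 + k / (8 * n)) = 1 := by
  have := lowValue_lt hk hn
  unfold tiltDensity
  rw [if_neg this.ne, if_neg (by linarith)]

theorem tiltDensity_three_quarters (k : ℕ) (e : ℝ) : tiltDensity k e (3 / 4) = 1 + e / k := by
  simp [tiltDensity]

theorem tiltDensity_one (k : ℕ) (e : ℝ) : tiltDensity k e 1 = 1 - e / k := by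
  unfold tiltDensity
  rw [if_neg (by norm_num), if_pos rfl]

/-- Both signs are compared with the midpoint `e = 0`, where the atoms at 3/4 and 1 have equal mass
k/(4n); the perturbation moves e/(4n) from one to the other, a relative change of e/k. -/
theorem highDist_eq_withDensity {n k : ℕ} (hk : 1 ≤ k) (hn : 2 * k ≤ n) (e : ℝ) :
    highDist n k e
      = (highDist n k 0).withDensity fun v => ENNReal.ofReal (tiltDensity k e v) := by
  have hk' : (1 : ℝ) ≤ k := by exact_mod_cast hk
  have hn' : 2 * (k : ℝ) ≤ n := by exact_mod_cast hn
  have hk0 : (k : ℝ) ≠ 0 := by linarith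
  have hn0 : (n : ℝ) ≠ 0 := by linarith
  have h0 : (0 : ℝ) ≤ k / (4 * n) := div_nonneg (by linarith) (by linarith)
  have hd : ∀ (c a : ℝ), (ENNReal.ofReal c • Measure.dirac a).withDensity
      (fun v => ENNReal.ofReal (tiltDensity k e v))
      = (ENNReal.ofReal c * ENNReal.ofReal (tiltDensity k e a)) • Measure.dirac a := by
    intro c a
    rw [withDensity_smul_measure]
    ext s hs
    rw [Measure.smul_apply, withDensity_apply _ hs, Measure.smul_apply, Measure.dirac_apply' _ hs,
      smul_eq_mul, smul_eq_mul, mul_assoc, ← lintegral_indicator hs, lintegral_dirac]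
    by_cases ha : a ∈ s <;> simp [ha]
  simp only [highDist, withDensity_add_measure, hd, tiltDensity_lowValue hk hn,
    tiltDensity_three_quarters, tiltDensity_one, ENNReal.ofReal_one, mul_one, add_zero, sub_zero]
  rw [← ENNReal.ofReal_mul h0, ← ENNReal.ofReal_mul h0]
  congr 5
  all_goals field_simp

/-- The linear terms cancel because the two atoms have equal mass; the quadratic term is (k/(2n))·(e
e'/k²). -/
theorem integral_tiltDensity_mul {n k : ℕ} (hk : 1 ≤ k) (hn : 2 * k ≤ n) (e e' : ℝ) :
    ∫ v, tiltDensity k e v * tiltDensity k e' v ∂(highDist n k 0) = 1 + e * e' / (2 * n * k) := by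
  have hk' : (1 : ℝ) ≤ k := by exact_mod_cast hk
  have hn' : 2 * (k : ℝ) ≤ n := by exact_mod_cast hn
  have hk0 : (k : ℝ) ≠ 0 := by linarith
  have hn0 : (n : ℝ) ≠ 0 := by linarith
  rw [integral_highDist hk hn (by simp), tiltDensity_lowValue hk hn, tiltDensity_lowValue hk hn,
    tiltDensity_three_quarters, tiltDensity_three_quarters, tiltDensity_one, tiltDensity_one]
  field_simp
  ring

end ThreePointLaws

/-! ### Indistinguishability of the two signs of one coordinate. -/

section Testing

/-- Pointwise AM–GM, f - g ≤ (s + (f-g)²/s)/2, takes the place of Cauchy–Schwarz and avoids a square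
root. The free parameter s should be about the L² distance. -/
theorem withDensity_real_sub_le {α : Type*} [MeasurableSpace α] (Q : Measure α)
    [IsProbabilityMeasure Q] {f g : α → ℝ} (hf : Measurable f) (hg : Measurable g)
    (hf0 : 0 ≤ f) (hg0 : 0 ≤ g) {B : ℝ} (hfB : ∀ x, f x ≤ B) (hgB : ∀ x, g x ≤ B)
    {T : Set α} (hT : MeasurableSet T) {s : ℝ} (hs : 0 < s) :
    (Q.withDensity fun x => ENNReal.ofReal (f x)).real T
      - (Q.withDensity fun x => ENNReal.ofReal (g x)).real T
      ≤ (s + (∫ x, (f x - g x) ^ 2 ∂Q) / s) / 2 := by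
  have hint : ∀ {h : α → ℝ}, Measurable h → 0 ≤ h → (∀ x, h x ≤ B) → Integrable h Q :=
    fun hm h0 hB => Integrable.of_bound hm.aestronglyMeasurable B
      (Filter.Eventually.of_forall fun x => by
        rw [Real.norm_of_nonneg (h0 x)]; exact hB x)
  have hreal : ∀ {h : α → ℝ}, Measurable h → 0 ≤ h → (∀ x, h x ≤ B) →
      (Q.withDensity fun x => ENNReal.ofReal (h x)).real T = ∫ x, T.indicator h x ∂Q := by
    intro h hm h0 hB
    rw [measureReal_def, withDensity_apply _ hT, integral_indicator hT,
      integral_eq_lintegral_of_nonneg_ae (Filter.Eventually.of_forall h0)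
        hm.aestronglyMeasurable]
  have hif := (hint hf hf0 hfB).indicator hT
  have hig := (hint hg hg0 hgB).indicator hT
  have hsq : Integrable (fun x => (f x - g x) ^ 2) Q := by
    refine Integrable.of_bound ((hf.sub hg).pow_const 2).aestronglyMeasurable (B ^ 2)
      (Filter.Eventually.of_forall fun x => ?_)
    have := hf0 x; have := hg0 x; have := hfB x; have := hgB x
    simp only [Pi.zero_apply] at *
    rw [Real.norm_of_nonneg (sq_nonneg _), ← sq_abs]
    exact pow_le_pow_left₀ (abs_nonneg _) (abs_le.2 ⟨by linarith, by linarith⟩) 2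
  rw [hreal hf hf0 hfB, hreal hg hg0 hgB, ← integral_sub hif hig]
  have hr : (s + (∫ x, (f x - g x) ^ 2 ∂Q) / s) / 2
      = ∫ x, (s + (f x - g x) ^ 2 / s) / 2 ∂Q := by
    rw [integral_div, integral_add (integrable_const _) (hsq.div_const _), integral_div]
    simp
  rw [hr]
  refine integral_mono (hif.sub hig)
    (((integrable_const s).add (hsq.div_const s)).div_const 2) fun x => ?_
  have h0 : 0 ≤ (f x - g x) ^ 2 / s := div_nonneg (sq_nonneg _) hs.le
  by_cases hx : x ∈ T
  · simp only [Set.indicator_of_mem hx]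
    have : f x - g x ≤ (s + (f x - g x) ^ 2 / s) / 2 := by
      have h1 : (s + (f x - g x) ^ 2 / s) / 2 - (f x - g x) = (s - (f x - g x)) ^ 2 / (2 * s) := by
        field_simp; ring
      have h2 : 0 ≤ (s - (f x - g x)) ^ 2 / (2 * s) := by positivity
      linarith
    exact this
  · simp only [Set.indicator_of_notMem hx, sub_zero]
    linarith

theorem valueLaw_update_withDensity {n : ℕ} (D : Fin n → Measure ℝ)
    [∀ i, IsProbabilityMeasure (D i)] (i : Fin n) {g : ℝ → ENNReal} (hg : Measurable g)
    [IsProbabilityMeasure ((D i).withDensity g)] :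
    valueLaw (Function.update D i ((D i).withDensity g))
      = (valueLaw D).withDensity fun v => g (v i) := by
  have h1 : Function.update D i ((D i).withDensity g)
      = fun j => (D j).withDensity (if j = i then g else 1) := by
    ext1 j
    by_cases h : j = i
    · subst h; simp
    · simp [h, withDensity_one]
  have : ∀ j, IsProbabilityMeasure ((D j).withDensity (if j = i then g else 1)) := by
    intro j
    by_cases h : j = i
    · subst h; simpa
    · simp only [h, if_false, withDensity_one]; infer_instance
  rw [h1, valueLaw, pi_withDensity D (fun j => if j = i then g else 1), valueLaw]
  · congr 1
    ext v
    rw [Finset.prod_eq_single i]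
    · simp
    · intro j _ hj; simp [hj]
    · simp
  · intro j
    by_cases h : j = i
    · simpa [h] using hg
    · simp only [h, if_false]; exact measurable_one

theorem runLaw_update_withDensity {n m : ℕ} (D : Fin n → Measure ℝ)
    [∀ i, IsProbabilityMeasure (D i)] (i : Fin n) {g : ℝ → ENNReal} (hg : Measurable g)
    [IsProbabilityMeasure ((D i).withDensity g)] {Ω : Type*} [MeasurableSpace Ω]
    (P : Measure Ω) [IsProbabilityMeasure P] :
    runLaw m (Function.update D i ((D i).withDensity g)) P
      = (runLaw m D P).withDensity fun q => ∏ t, g (q.1 t i) := by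
  have hD : IsProbabilityMeasure (valueLaw D) := by unfold valueLaw; infer_instance
  have hU : IsProbabilityMeasure ((valueLaw D).withDensity fun v => g (v i)) := by
    rw [← valueLaw_update_withDensity D i hg]
    have : ∀ j, IsProbabilityMeasure (Function.update D i ((D i).withDensity g) j) := by
      intro j
      by_cases h : j = i
      · subst h; simpa
      · simpa [h] using (inferInstance : IsProbabilityMeasure (D j))
    unfold valueLaw; infer_instance
  have hgi : Measurable fun v : Fin n → ℝ => g (v i) := hg.comp (measurable_pi_apply i)
  have hm : Measurable fun x : Fin m → Fin n → ℝ => ∏ t, g (x t i) :=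
    Finset.measurable_fun_prod _ fun t _ => hgi.comp (measurable_pi_apply t)
  rw [runLaw, valueLaw_update_withDensity D i hg,
    pi_withDensity (fun _ : Fin m => valueLaw D) (fun _ v => g (v i)) (fun _ => hgi), runLaw,
    prod_withDensity_left hm]

end Testing

section Testing

theorem isProbabilityMeasure_update {n : ℕ} {D : Fin n → Measure ℝ}
    [∀ i, IsProbabilityMeasure (D i)] (i : Fin n) {ν : Measure ℝ} [IsProbabilityMeasure ν]
    (j : Fin n) : IsProbabilityMeasure (Function.update D i ν j) := by
  by_cases h : j = i
  · subst h; simpa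
  · simpa [h] using (inferInstance : IsProbabilityMeasure (D j))

theorem isProbabilityMeasure_valueLaw {n : ℕ} (D : Fin n → Measure ℝ)
    [∀ i, IsProbabilityMeasure (D i)] : IsProbabilityMeasure (valueLaw D) := by
  unfold valueLaw; infer_instance

theorem isProbabilityMeasure_runLaw {n m : ℕ} (D : Fin n → Measure ℝ)
    [∀ i, IsProbabilityMeasure (D i)] {Ω : Type*} [MeasurableSpace Ω]
    (P : Measure Ω) [IsProbabilityMeasure P] : IsProbabilityMeasure (runLaw m D P) := by
  have := isProbabilityMeasure_valueLaw D
  unfold runLaw; infer_instance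

theorem integral_runLaw_prod {n m : ℕ} (D : Fin n → Measure ℝ)
    [∀ i, IsProbabilityMeasure (D i)] (i : Fin n) {Ω : Type*} [MeasurableSpace Ω]
    (P : Measure Ω) [IsProbabilityMeasure P] {h : ℝ → ℝ} (hh : Measurable h) :
    ∫ q, ∏ t, h (q.1 t i) ∂(runLaw m D P) = (∫ v, h v ∂(D i)) ^ m := by
  have := isProbabilityMeasure_valueLaw D
  have h1 := integral_fun_fst (μ := Measure.pi fun _ : Fin m => valueLaw D) (ν := P)
    (fun x : Fin m → Fin n → ℝ => ∏ t, h (x t i))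
  have h2 := integral_fintype_prod_eq_pow (ι := Fin m) (μ := valueLaw D)
    (fun v : Fin n → ℝ => h (v i))
  have h3 := integral_comp_eval (μ := D) (i := i) (f := h) hh.aestronglyMeasurable
  rw [runLaw, h1, h2, valueLaw, h3]
  simp

/-- Relative to the law with `e = 0` in coordinate i, the likelihood ratios are products over
samples, so the squared L² distance expands into m-th powers of 1 ± ε²/(2nk). -/
theorem runLaw_highDist_sub_le {n k m : ℕ} (hk : 1 ≤ k) (hn : 2 * k ≤ n) {ε : ℝ}
    (hε : |ε| ≤ k) (hm : m * (ε ^ 2 / (2 * n * k)) ≤ 1 / 1000) (D : Fin n → Measure ℝ)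
    [∀ i, IsProbabilityMeasure (D i)] (i : Fin n) {Ω : Type*} [MeasurableSpace Ω]
    (P : Measure Ω) [IsProbabilityMeasure P] {T : Set ((Fin m → Fin n → ℝ) × Ω)}
    (hT : MeasurableSet T) :
    (runLaw m (Function.update D i (highDist n k ε)) P).real T
      - (runLaw m (Function.update D i (highDist n k (-ε))) P).real T ≤ 1 / 10 := by
  have hk' : (1 : ℝ) ≤ k := by exact_mod_cast hk
  have hn' : 2 * (k : ℝ) ≤ n := by exact_mod_cast hn
  have hε' : |-ε| ≤ k := by rwa [abs_neg]
  have p0 : IsProbabilityMeasure (highDist n k 0) := isProbabilityMeasure_highDist hk hn (by simp)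
  set D₀ := Function.update D i (highDist n k 0) with hD₀
  have pD : ∀ j, IsProbabilityMeasure (D₀ j) := isProbabilityMeasure_update i
  have hi : D₀ i = highDist n k 0 := Function.update_self ..
  have hup : ∀ e : ℝ, |e| ≤ k → runLaw m (Function.update D i (highDist n k e)) P
      = (runLaw m D₀ P).withDensity
        fun q => ENNReal.ofReal (∏ t, tiltDensity k e (q.1 t i)) := by
    intro e he
    have hd := highDist_eq_withDensity hk hn e
    rw [← hi] at hd
    have pe : IsProbabilityMeasure
        ((D₀ i).withDensity fun v => ENNReal.ofReal (tiltDensity k e v)) := by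
      rw [← hd]; exact isProbabilityMeasure_highDist hk hn he
    have := runLaw_update_withDensity (m := m) D₀ i
      (measurable_tiltDensity k e).ennreal_ofReal P
    rw [← hd, hD₀, Function.update_idem] at this
    rw [this]
    congr 1
    ext q
    rw [ENNReal.ofReal_prod_of_nonneg fun t _ => tiltDensity_nonneg hk he _]
  have pR := isProbabilityMeasure_runLaw (m := m) D₀ P
  have hmeas : ∀ e : ℝ, Measurable fun q : (Fin m → Fin n → ℝ) × Ω =>
      ∏ t, tiltDensity k e (q.1 t i) := fun e =>
    Finset.measurable_fun_prod _ fun t _ => (measurable_tiltDensity k e).comp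
      ((measurable_pi_apply i).comp ((measurable_pi_apply t).comp measurable_fst))
  have h0 : ∀ e : ℝ, |e| ≤ k → 0 ≤ fun q : (Fin m → Fin n → ℝ) × Ω =>
      ∏ t, tiltDensity k e (q.1 t i) := fun e he q =>
    Finset.prod_nonneg fun t _ => tiltDensity_nonneg hk he _
  have hB : ∀ e : ℝ, |e| ≤ k → ∀ q : (Fin m → Fin n → ℝ) × Ω,
      ∏ t, tiltDensity k e (q.1 t i) ≤ 2 ^ m := fun e he q => by
    refine (Finset.prod_le_prod (fun t _ => tiltDensity_nonneg hk he _)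
      (fun t _ => tiltDensity_le_two hk he _)).trans_eq ?_
    simp
  -- Writing a = ε²/(2nk), the squared distance will be at most 6ma ≤ 6/1000, so s = 1/10 yields
  -- (0.1 + 0.06)/2 = 0.08.
  have key := withDensity_real_sub_le (runLaw m D₀ P) (hmeas ε) (hmeas (-ε)) (h0 ε hε) (h0 _ hε')
    (hB ε hε) (hB _ hε') hT (s := 1 / 10) (by norm_num)
  have hint : ∀ e e' : ℝ, |e| ≤ k → |e'| ≤ k →
      Integrable (fun q : (Fin m → Fin n → ℝ) × Ω =>
      (∏ t, tiltDensity k e (q.1 t i)) * ∏ t, tiltDensity k e' (q.1 t i)) (runLaw m D₀ P) := by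
    intro e e' he he'
    refine Integrable.of_bound ((hmeas e).mul (hmeas e')).aestronglyMeasurable (2 ^ m * 2 ^ m)
      (Filter.Eventually.of_forall fun q => ?_)
    rw [Real.norm_of_nonneg (mul_nonneg (h0 e he q) (h0 e' he' q))]
    exact mul_le_mul (hB e he q) (hB e' he' q) (h0 e' he' q) (by positivity)
  have hprod : ∀ e e' : ℝ, ∫ q, (∏ t, tiltDensity k e (q.1 t i)) *
      ∏ t, tiltDensity k e' (q.1 t i) ∂(runLaw m D₀ P) = (1 + e * e' / (2 * n * k)) ^ m := by
    intro e e'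
    simp_rw [← Finset.prod_mul_distrib]
    rw [integral_runLaw_prod D₀ i P (h := fun v => tiltDensity k e v * tiltDensity k e' v)
      ((measurable_tiltDensity k e).mul (measurable_tiltDensity k e')), hi,
      integral_tiltDensity_mul hk hn]
  have hsq : ∫ q, ((∏ t, tiltDensity k ε (q.1 t i)) - ∏ t, tiltDensity k (-ε) (q.1 t i)) ^ 2
      ∂(runLaw m D₀ P) = 2 * (1 + ε ^ 2 / (2 * n * k)) ^ m - 2 * (1 - ε ^ 2 / (2 * n * k)) ^ m := by
    have hx : ∀ q : (Fin m → Fin n → ℝ) × Ω,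
        ((∏ t, tiltDensity k ε (q.1 t i)) - ∏ t, tiltDensity k (-ε) (q.1 t i)) ^ 2
        = (∏ t, tiltDensity k ε (q.1 t i)) * (∏ t, tiltDensity k ε (q.1 t i))
          + (∏ t, tiltDensity k (-ε) (q.1 t i)) * (∏ t, tiltDensity k (-ε) (q.1 t i))
          - 2 * ((∏ t, tiltDensity k ε (q.1 t i)) * ∏ t, tiltDensity k (-ε) (q.1 t i)) :=
      fun q => by ring
    simp_rw [hx]
    have hadd : Integrable (fun q : (Fin m → Fin n → ℝ) × Ω =>
        (∏ t, tiltDensity k ε (q.1 t i)) * (∏ t, tiltDensity k ε (q.1 t i))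
          + (∏ t, tiltDensity k (-ε) (q.1 t i)) * (∏ t, tiltDensity k (-ε) (q.1 t i)))
        (runLaw m D₀ P) := (hint _ _ hε hε).add (hint _ _ hε' hε')
    rw [integral_sub hadd ((hint _ _ hε hε').const_mul 2),
      integral_add (hint _ _ hε hε) (hint _ _ hε' hε'), integral_const_mul, hprod, hprod, hprod]
    ring
  rw [hup ε hε, hup (-ε) hε']
  refine key.trans ?_
  rw [hsq]
  set a := ε ^ 2 / (2 * n * k) with ha
  have ha0 : 0 ≤ a := by positivity
  have ha1 : a ≤ 1 := by
    rw [ha, div_le_one (by nlinarith)]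
    nlinarith [sq_abs ε, abs_nonneg ε]
  have hlo : 1 - m * a ≤ (1 - a) ^ m := by
    have := one_add_mul_le_pow (a := -a) (by linarith) m
    calc 1 - m * a = 1 + m * -a := by ring
      _ ≤ (1 + -a) ^ m := this
      _ = (1 - a) ^ m := by ring
  have hup' : (1 + a) ^ m ≤ 1 + 2 * (m * a) := by
    have h1 : (1 + a) ^ m ≤ Real.exp (m * a) := by
      rw [Real.exp_nat_mul]
      exact pow_le_pow_left₀ (by linarith) (by linarith [Real.add_one_le_exp a]) m
    have hma : 0 ≤ m * a := by positivity
    have h2 := Real.abs_exp_sub_one_le (x := m * a) (by rw [abs_of_nonneg hma]; linarith)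
    rw [abs_of_nonneg hma] at h2
    linarith [le_abs_self (Real.exp (m * a) - 1)]
  linarith

end Testing

/-! ### Interim allocations and payments. -/

section Interim

/-- Interim allocation of bidder `i` when she bids `b`. -/
noncomputable def interimAlloc {n k : ℕ} (M : Mechanism n k) (D : Fin n → Measure ℝ) (i : Fin n)
    (b : ℝ) : ℝ :=
  ∫ v, M.alloc (Function.update v i b) i ∂(valueLaw D)

/-- Interim payment of bidder `i` when she bids `b`. -/
noncomputable def interimPay {n k : ℕ} (M : Mechanism n k) (D : Fin n → Measure ℝ) (i : Fin n)
    (b : ℝ) : ℝ :=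
  ∫ v, M.pay (Function.update v i b) i ∂(valueLaw D)

theorem ae_nonneg_valueLaw {n : ℕ} {D : Fin n → Measure ℝ} [∀ i, IsProbabilityMeasure (D i)]
    (hD : ∀ i, ∀ᵐ x ∂(D i), 0 ≤ x) : ∀ᵐ v ∂(valueLaw D), 0 ≤ v := by
  have : ∀ i, ∀ᵐ v ∂(valueLaw D), 0 ≤ v i := fun i =>
    (Measure.tendsto_eval_ae_ae (μ := D) (i := i)).eventually (hD i)
  filter_upwards [ae_all_iff.2 this] with v hv using hv

theorem update_nonneg {n : ℕ} {v : Fin n → ℝ} (hv : 0 ≤ v) (i : Fin n) {b : ℝ} (hb : 0 ≤ b) :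
    0 ≤ Function.update v i b := by
  intro j
  by_cases h : j = i
  · subst h; simpa
  · simpa [h] using hv j

theorem integrable_alloc {n k : ℕ} (M : Mechanism n k) {D : Fin n → Measure ℝ}
    [∀ i, IsProbabilityMeasure (D i)] (hD : ∀ i, ∀ᵐ x ∂(D i), 0 ≤ x) (i : Fin n) :
    Integrable (fun v => M.alloc v i) (valueLaw D) := by
  have := isProbabilityMeasure_valueLaw D
  refine Integrable.of_bound (M.measurable_alloc i).aestronglyMeasurable 1 ?_
  filter_upwards [ae_nonneg_valueLaw hD] with v hv
  rw [Real.norm_of_nonneg (M.alloc_nonneg v hv i)]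
  exact M.alloc_le_one v hv i

theorem integrable_alloc_update {n k : ℕ} (M : Mechanism n k) {D : Fin n → Measure ℝ}
    [∀ i, IsProbabilityMeasure (D i)] (hD : ∀ i, ∀ᵐ x ∂(D i), 0 ≤ x) (i : Fin n) {b : ℝ}
    (hb : 0 ≤ b) :
    Integrable (fun v => M.alloc (Function.update v i b) i) (valueLaw D) := by
  have := isProbabilityMeasure_valueLaw D
  refine Integrable.of_bound
    ((M.measurable_alloc i).comp (measurable_update_const (X := fun _ => ℝ) i b) :
      Measurable fun v => M.alloc (Function.update v i b) i).aestronglyMeasurable 1 ?_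
  filter_upwards [ae_nonneg_valueLaw hD] with v hv
  rw [Real.norm_of_nonneg (M.alloc_nonneg _ (update_nonneg hv i hb) i)]
  exact M.alloc_le_one _ (update_nonneg hv i hb) i

theorem IsBIC.interimUtility_eq {n k : ℕ} {M : Mechanism n k} {D : Fin n → Measure ℝ}
    [∀ i, IsProbabilityMeasure (D i)] (hM : IsBIC M D) (hD : ∀ i, ∀ᵐ x ∂(D i), 0 ≤ x)
    (i : Fin n) (t : ℝ) {b : ℝ} (hb : 0 ≤ b) :
    interimUtility M D i t b = t * interimAlloc M D i b - interimPay M D i b := by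
  rw [interimUtility, integral_sub ((integrable_alloc_update M hD i hb).const_mul t)
    (hM.integrable_pay_update i b hb), integral_const_mul]
  rfl

end Interim

/-! ### Virtual-value upper bound on BIC revenue for the hard profiles. -/

section HardProfile

/-- The product distribution with base bidders `i < k` and perturbation `e i` for the others. -/
noncomputable def hardProfile (n k : ℕ) (e : Fin n → ℝ) (i : Fin n) : Measure ℝ :=
  if (i : ℕ) < k then baseDist else highDist n k (e i)

/-- Virtual value (before ironing) of `highDist n k e` minus `1/2`, extended to all values. -/
noncomputable def excessVirtualValue (k : ℕ) (e v : ℝ) : ℝ :=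
  if 1 ≤ v then 1 / 2 else if 3 / 4 ≤ v then e / (2 * (k + e)) else 0

/-- Excess virtual value of bidder `i`, which is zero for base bidders. -/
noncomputable def excessWeight {n : ℕ} (k : ℕ) (e : Fin n → ℝ) (i : Fin n) (v : ℝ) : ℝ :=
  if (i : ℕ) < k then 0 else excessVirtualValue k (e i) v

variable {n k : ℕ}

theorem isProbabilityMeasure_hardProfile (hk : 1 ≤ k) (hn : 2 * k ≤ n) {e : Fin n → ℝ}
    (he : ∀ i, |e i| < k) (i : Fin n) : IsProbabilityMeasure (hardProfile n k e i) := by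
  unfold hardProfile
  split_ifs
  · unfold baseDist; infer_instance
  · exact isProbabilityMeasure_highDist hk hn (he i).le

theorem hardProfile_ae_nonneg (e : Fin n → ℝ) (i : Fin n) :
    ∀ᵐ x ∂(hardProfile n k e i), 0 ≤ x := by
  unfold hardProfile
  split_ifs
  · rw [baseDist, ae_dirac_eq]; norm_num
  · exact ae_highDist_iff (by positivity) (by norm_num) (by norm_num)

theorem measurable_excessVirtualValue (k : ℕ) (e : ℝ) : Measurable (excessVirtualValue k e) :=
  Measurable.ite measurableSet_Ici measurable_const
    (Measurable.ite measurableSet_Ici measurable_const measurable_const)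

theorem measurable_excessWeight (e : Fin n → ℝ) (i : Fin n) :
    Measurable (excessWeight k e i) := by
  unfold excessWeight
  split_ifs
  · exact measurable_const
  · exact measurable_excessVirtualValue k (e i)

theorem excessWeight_base {e : Fin n → ℝ} {i : Fin n} (hi : (i : ℕ) < k) (v : ℝ) :
    excessWeight k e i v = 0 := if_pos hi

theorem excessWeight_low {e : Fin n → ℝ} {i : Fin n} {v : ℝ} (hv : v < 3 / 4) :
    excessWeight k e i v = 0 := by
  unfold excessWeight excessVirtualValue
  rw [if_neg (by linarith : ¬ 1 ≤ v), if_neg (by linarith : ¬ 3 / 4 ≤ v), ite_self]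

theorem excessWeight_mid {e : Fin n → ℝ} {i : Fin n} (hi : ¬ (i : ℕ) < k) {v : ℝ}
    (hv : 3 / 4 ≤ v) (hv' : v < 1) :
    excessWeight k e i v = e i / (2 * (k + e i)) := by
  unfold excessWeight excessVirtualValue
  rw [if_neg hi, if_neg (by linarith : ¬ 1 ≤ v), if_pos hv]

theorem excessWeight_high {e : Fin n → ℝ} {i : Fin n} (hi : ¬ (i : ℕ) < k) {v : ℝ}
    (hv : 1 ≤ v) : excessWeight k e i v = 1 / 2 := by
  unfold excessWeight excessVirtualValue
  rw [if_neg hi, if_pos hv]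

theorem add_pos_of_abs_lt {e : ℝ} (he : |e| < k) : 0 < k + e := by
  linarith [(abs_lt.1 he).1]

/-- A uniform bound on the excess weights of a fixed bidder. -/
theorem exists_abs_excessWeight_le (e : Fin n → ℝ) (i : Fin n) :
    ∃ B : ℝ, 0 ≤ B ∧ ∀ v, |excessWeight k e i v| ≤ B := by
  refine ⟨1 / 2 + |e i / (2 * (k + e i))|, by positivity, fun v => ?_⟩
  have := abs_nonneg (e i / (2 * (k + e i)))
  unfold excessWeight excessVirtualValue
  split_ifs
  · simp only [abs_zero]; linarith
  · rw [abs_of_pos (by norm_num : (0 : ℝ) < 1 / 2)]; linarith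
  · linarith
  · simp only [abs_zero]; linarith

theorem integrable_excessWeight_mul {e : Fin n → ℝ} (i : Fin n) {μ : Measure (Fin n → ℝ)}
    {f : (Fin n → ℝ) → ℝ} (hf : Integrable f μ) :
    Integrable (fun v => excessWeight k e i (v i) * f v) μ := by
  obtain ⟨B, _, hB⟩ := exists_abs_excessWeight_le (k := k) e i
  exact hf.bdd_mul ((measurable_excessWeight e i).comp (measurable_pi_apply i)).aestronglyMeasurable
    (Filter.Eventually.of_forall fun v => hB (v i))

theorem integral_hardProfile_base (hk : 1 ≤ k) (hn : 2 * k ≤ n) {e : Fin n → ℝ}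
    (he : ∀ i, |e i| < k) {i : Fin n} (hi : (i : ℕ) < k) {f : (Fin n → ℝ) → ℝ}
    (hf : Integrable f (valueLaw (hardProfile n k e))) :
    ∫ v, f v ∂(valueLaw (hardProfile n k e))
      = ∫ v, f (Function.update v i (1 / 2)) ∂(valueLaw (hardProfile n k e)) := by
  have := isProbabilityMeasure_hardProfile hk hn he
  conv_lhs => rw [valueLaw, integral_pi_eq_integral_update _ i hf, hardProfile, if_pos hi, baseDist,
    integral_dirac]
  rfl

theorem integral_hardProfile_nonbase (hk : 1 ≤ k) (hn : 2 * k ≤ n) {e : Fin n → ℝ}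
    (he : ∀ i, |e i| < k) {i : Fin n} (hi : ¬ (i : ℕ) < k) {f : (Fin n → ℝ) → ℝ}
    (hf : Integrable f (valueLaw (hardProfile n k e))) :
    ∫ v, f v ∂(valueLaw (hardProfile n k e))
      = (1 - k / (2 * n))
          * ∫ v, f (Function.update v i (1 / 2 + k / (8 * n))) ∂(valueLaw (hardProfile n k e))
        + (k + e i) / (4 * n)
          * ∫ v, f (Function.update v i (3 / 4)) ∂(valueLaw (hardProfile n k e))
        + (k - e i) / (4 * n)
          * ∫ v, f (Function.update v i 1) ∂(valueLaw (hardProfile n k e)) := by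
  have := isProbabilityMeasure_hardProfile hk hn he
  conv_lhs => rw [valueLaw, integral_pi_eq_integral_update _ i hf, hardProfile, if_neg hi,
    integral_highDist hk hn (he i).le]
  rfl

theorem integral_excessWeight_mul (hk : 1 ≤ k) (hn : 2 * k ≤ n) {e : Fin n → ℝ}
    (he : ∀ i, |e i| < k) {i : Fin n} (hi : ¬ (i : ℕ) < k) {f : (Fin n → ℝ) → ℝ}
    (hf : Integrable f (valueLaw (hardProfile n k e))) :
    ∫ v, excessWeight k e i (v i) * f v ∂(valueLaw (hardProfile n k e))
      = e i / (8 * n) * ∫ v, f (Function.update v i (3 / 4)) ∂(valueLaw (hardProfile n k e))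
        + (k - e i) / (8 * n)
          * ∫ v, f (Function.update v i 1) ∂(valueLaw (hardProfile n k e)) := by
  have hn0 : (0 : ℝ) < n := by
    have : (1 : ℝ) ≤ k := by exact_mod_cast hk
    have : 2 * (k : ℝ) ≤ n := by exact_mod_cast hn
    linarith
  have hke := add_pos_of_abs_lt (he i)
  rw [integral_hardProfile_nonbase hk hn he hi (integrable_excessWeight_mul i hf)]
  simp only [Function.update_self, excessWeight_low (lowValue_lt hk hn),
    excessWeight_mid hi (le_refl (3 / 4 : ℝ)) (by norm_num), excessWeight_high hi (le_refl (1 : ℝ)),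
    integral_const_mul, zero_mul, mul_zero, integral_zero]
  field_simp
  ring

theorem IsBIC.integral_pay_base_le (hk : 1 ≤ k) (hn : 2 * k ≤ n) {e : Fin n → ℝ}
    (he : ∀ i, |e i| < k) {M : Mechanism n k} (hM : IsBIC M (hardProfile n k e)) {i : Fin n}
    (hi : (i : ℕ) < k) :
    ∫ v, M.pay v i ∂(valueLaw (hardProfile n k e))
      ≤ 1 / 2 * ∫ v, M.alloc v i ∂(valueLaw (hardProfile n k e)) := by
  have := isProbabilityMeasure_hardProfile hk hn he
  have hD := hardProfile_ae_nonneg (k := k) e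
  rw [integral_hardProfile_base hk hn he hi (hM.integrable_pay i),
    integral_hardProfile_base hk hn he hi (integrable_alloc M hD i)]
  have h := hM.rational i (1 / 2) (by norm_num)
  rw [hM.interimUtility_eq hD i _ (by norm_num), interimAlloc, interimPay] at h
  linarith

/-- Only rationality at the lowest value and the two adjacent downward incentive constraints are
needed. The lowest value is tuned so that its virtual value is 1/2: the gap to 3/4 is (1/4)(1 -
k/(2n)), which makes the information rent per unit of low mass equal to k/(8n). -/
theorem IsBIC.integral_pay_nonbase_le (hk : 1 ≤ k) (hn : 2 * k ≤ n) {e : Fin n → ℝ}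
    (he : ∀ i, |e i| < k) {M : Mechanism n k} (hM : IsBIC M (hardProfile n k e)) {i : Fin n}
    (hi : ¬ (i : ℕ) < k) :
    ∫ v, M.pay v i ∂(valueLaw (hardProfile n k e))
      ≤ 1 / 2 * ∫ v, M.alloc v i ∂(valueLaw (hardProfile n k e))
        + ∫ v, excessWeight k e i (v i) * M.alloc v i ∂(valueLaw (hardProfile n k e)) := by
  have := isProbabilityMeasure_hardProfile hk hn he
  have hD := hardProfile_ae_nonneg (k := k) e
  have hk' : (1 : ℝ) ≤ k := by exact_mod_cast hk
  have hn' : 2 * (k : ℝ) ≤ n := by exact_mod_cast hn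
  have hn0 : (0 : ℝ) < n := by linarith
  have hv3 : (0 : ℝ) ≤ 1 / 2 + k / (8 * n) := by positivity
  rw [integral_hardProfile_nonbase hk hn he hi (hM.integrable_pay i),
    integral_hardProfile_nonbase hk hn he hi (integrable_alloc M hD i),
    integral_excessWeight_mul hk hn he hi (integrable_alloc M hD i)]
  have h3 := hM.rational i (1 / 2 + k / (8 * n)) hv3
  have h2 := hM.truthful i (3 / 4) (1 / 2 + k / (8 * n)) (by norm_num) hv3
  have h1 := hM.truthful i 1 (3 / 4) (by norm_num) (by norm_num)
  rw [hM.interimUtility_eq hD i _ hv3] at h3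
  rw [hM.interimUtility_eq hD i _ hv3, hM.interimUtility_eq hD i _ (by norm_num)] at h2
  rw [hM.interimUtility_eq hD i _ (by norm_num), hM.interimUtility_eq hD i _ (by norm_num)] at h1
  simp only [interimAlloc, interimPay] at *
  generalize ∫ v, M.alloc (Function.update v i (1 / 2 + k / (8 * n))) i ∂_ = X3 at *
  generalize ∫ v, M.alloc (Function.update v i (3 / 4)) i ∂_ = X2 at *
  generalize ∫ v, M.alloc (Function.update v i 1) i ∂_ = X1 at *
  generalize ∫ v, M.pay (Function.update v i (1 / 2 + k / (8 * n))) i ∂_ = P3 at *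
  generalize ∫ v, M.pay (Function.update v i (3 / 4)) i ∂_ = P2 at *
  generalize ∫ v, M.pay (Function.update v i 1) i ∂_ = P1 at *
  have hq : (0 : ℝ) ≤ k / (2 * n) := by positivity
  have hq1 : 0 ≤ (k - e i) / (4 * n) :=
    div_nonneg (by linarith [(abs_lt.1 (he i)).2]) (by linarith)
  -- The multipliers of the three constraints are the upper tail probabilities: 1, then k/(2n) for
  -- values at least 3/4, then (k - e i)/(4n) for value 1.
  have m2 := mul_nonneg hq (sub_nonneg.2 h2)
  have m1 := mul_nonneg hq1 (sub_nonneg.2 h1)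
  rw [← sub_nonneg]
  refine (add_nonneg (add_nonneg h3 m2) m1).trans_eq ?_
  field_simp
  ring

theorem IsBIC.revenue_le (hk : 1 ≤ k) (hn : 2 * k ≤ n) {e : Fin n → ℝ}
    (he : ∀ i, |e i| < k) {M : Mechanism n k} (hM : IsBIC M (hardProfile n k e)) :
    revenue M (hardProfile n k e)
      ≤ k / 2 + ∫ v, ∑ i, excessWeight k e i (v i) * M.alloc v i
          ∂(valueLaw (hardProfile n k e)) := by
  have := isProbabilityMeasure_hardProfile hk hn he
  have hμ := isProbabilityMeasure_valueLaw (hardProfile n k e)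
  have hD := hardProfile_ae_nonneg (k := k) e
  have hia := fun i => integrable_alloc M hD i
  have hle : ∀ i, ∫ v, M.pay v i ∂(valueLaw (hardProfile n k e))
      ≤ 1 / 2 * ∫ v, M.alloc v i ∂(valueLaw (hardProfile n k e))
        + ∫ v, excessWeight k e i (v i) * M.alloc v i ∂(valueLaw (hardProfile n k e)) := by
    intro i
    by_cases hi : (i : ℕ) < k
    · simpa [excessWeight_base hi] using hM.integral_pay_base_le hk hn he hi
    · exact hM.integral_pay_nonbase_le hk hn he hi
  have hsum : ∑ i, ∫ v, M.alloc v i ∂(valueLaw (hardProfile n k e)) ≤ k := by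
    rw [← integral_finsetSum _ fun i _ => hia i]
    calc ∫ v, ∑ i, M.alloc v i ∂(valueLaw (hardProfile n k e))
        ≤ ∫ _, (k : ℝ) ∂(valueLaw (hardProfile n k e)) := by
          refine integral_mono_ae (integrable_finsetSum _ fun i _ => hia i)
            (integrable_const _) ?_
          filter_upwards [ae_nonneg_valueLaw hD] with v hv using M.sum_alloc_le v hv
      _ = k := by simp
  rw [revenue, integral_finsetSum _ fun i _ => hM.integrable_pay i,
    integral_finsetSum _ fun i _ => integrable_excessWeight_mul i (hia i)]
  refine (Finset.sum_le_sum fun i _ => hle i).trans ?_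
  rw [Finset.sum_add_distrib, ← Finset.mul_sum]
  linarith

end HardProfile

/-! ### Weight-maximizing fractional allocations and their monotonicity. -/

section BestAllocation

/-- Fractional allocations of `k` units to `n` bidders. -/
def feasibleAllocs (n k : ℕ) : Set (Fin n → ℝ) :=
  {x | (∀ i, 0 ≤ x i ∧ x i ≤ 1) ∧ ∑ i, x i ≤ k}

theorem exists_best_alloc (n k : ℕ) (w : Fin n → ℝ) :
    ∃ x ∈ feasibleAllocs n k, ∀ y ∈ feasibleAllocs n k, ∑ i, w i * y i ≤ ∑ i, w i * x i := by
  have hc : IsCompact (feasibleAllocs n k) := by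
    have h1 : feasibleAllocs n k
        = Set.Icc (0 : Fin n → ℝ) 1 ∩ {x : Fin n → ℝ | ∑ i, x i ≤ k} := by
      ext x
      simp [feasibleAllocs, Pi.le_def, forall_and]
    rw [h1]
    exact isCompact_Icc.inter_right (isClosed_le (by fun_prop) continuous_const)
  have hne : (feasibleAllocs n k).Nonempty := ⟨0, by simp [feasibleAllocs]⟩
  have hcont : Continuous fun x : Fin n → ℝ => ∑ i, w i * x i := by fun_prop
  obtain ⟨x, hx, hmax⟩ := hc.exists_isMaxOn hne hcont.continuousOn
  exact ⟨x, hx, fun y hy => hmax hy⟩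

/-- A fractional allocation of `k` units that maximizes the total weight. -/
noncomputable def bestAlloc {n : ℕ} (k : ℕ) (w : Fin n → ℝ) : Fin n → ℝ :=
  (exists_best_alloc n k w).choose

theorem bestAlloc_mem {n : ℕ} (k : ℕ) (w : Fin n → ℝ) : bestAlloc k w ∈ feasibleAllocs n k :=
  (exists_best_alloc n k w).choose_spec.1

theorem le_bestAlloc {n k : ℕ} (w : Fin n → ℝ) {y : Fin n → ℝ} (hy : y ∈ feasibleAllocs n k) :
    ∑ i, w i * y i ≤ ∑ i, w i * bestAlloc k w i :=
  (exists_best_alloc n k w).choose_spec.2 y hy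

/-- Adding the two optimality inequalities leaves (b - a)(y i - x i) ≥ 0, whichever maximizers were
chosen. -/
theorem bestAlloc_update_mono {n k : ℕ} (w : Fin n → ℝ) (i : Fin n) {a b : ℝ} (hab : a < b) :
    bestAlloc k (Function.update w i a) i ≤ bestAlloc k (Function.update w i b) i := by
  set x := bestAlloc k (Function.update w i a)
  set y := bestAlloc k (Function.update w i b)
  have h1 : ∑ j, Function.update w i a j * y j ≤ ∑ j, Function.update w i a j * x j :=
    le_bestAlloc _ (bestAlloc_mem k _)
  have h2 : ∑ j, Function.update w i b j * x j ≤ ∑ j, Function.update w i b j * y j :=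
    le_bestAlloc _ (bestAlloc_mem k _)
  have h3 : ∀ (c : ℝ) (z : Fin n → ℝ), ∑ j, Function.update w i c j * z j
      = c * z i + ∑ j ∈ Finset.univ.erase i, w j * z j := by
    intro c z
    rw [← Finset.add_sum_erase _ _ (Finset.mem_univ i), Function.update_self]
    congr 1
    exact Finset.sum_congr rfl fun j hj => by
      rw [Function.update_of_ne (Finset.mem_erase.1 hj).1]
  rw [h3, h3] at h1 h2
  nlinarith

end BestAllocation

/-! ### A dominant-strategy mechanism that attains the virtual-value bound. -/

section ReferenceMechanism

variable {n : ℕ} (k : ℕ) (e : Fin n → ℝ)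

/-- The level of a value: `2` from `1` on, `1` on `[3/4, 1)`, and `0` below `3/4`. -/
noncomputable def valueLevel (v : ℝ) : Fin 3 :=
  if 1 ≤ v then 2 else if 3 / 4 ≤ v then 1 else 0

/-- The levels of the bids, with level `0` for base bidders. -/
noncomputable def bidLevels (b : Fin n → ℝ) (i : Fin n) : Fin 3 :=
  if (i : ℕ) < k then 0 else valueLevel (b i)

/-- The positive part of the excess virtual value at a given level. -/
noncomputable def levelWeight (l : Fin n → Fin 3) (i : Fin n) : ℝ :=
  if l i = 2 then 1 / 2 else if l i = 1 then max (e i / (2 * (k + e i))) 0 else 0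

/-- Allocation of the reference mechanism to bidders that are not base bidders. -/
noncomputable def levelAlloc (l : Fin n → Fin 3) (i : Fin n) : ℝ :=
  if l i = 2 then bestAlloc k (levelWeight k e l) i
  else if l i = 1 ∧ 0 < e i then bestAlloc k (levelWeight k e l) i else 0

/-- Payment in the reference mechanism of bidders that are not base bidders. -/
noncomputable def levelPay (l : Fin n → Fin 3) (i : Fin n) : ℝ :=
  if l i = 2 then levelAlloc k e l i - 1 / 4 * levelAlloc k e (Function.update l i 1) i
  else 3 / 4 * levelAlloc k e l i

theorem levelAlloc_nonneg (l : Fin n → Fin 3) (i : Fin n) : 0 ≤ levelAlloc k e l i := by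
  have := ((bestAlloc_mem k (levelWeight k e l)).1 i).1
  unfold levelAlloc
  split_ifs <;> first | assumption | exact le_rfl

theorem levelAlloc_le_best (l : Fin n → Fin 3) (i : Fin n) :
    levelAlloc k e l i ≤ bestAlloc k (levelWeight k e l) i := by
  have := ((bestAlloc_mem k (levelWeight k e l)).1 i).1
  unfold levelAlloc
  split_ifs <;> first | assumption | exact le_rfl

theorem levelAlloc_le_one (l : Fin n → Fin 3) (i : Fin n) : levelAlloc k e l i ≤ 1 :=
  (levelAlloc_le_best k e l i).trans ((bestAlloc_mem k _).1 i).2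

theorem sum_levelAlloc_le (l : Fin n → Fin 3) : ∑ i, levelAlloc k e l i ≤ k :=
  (Finset.sum_le_sum fun i _ => levelAlloc_le_best k e l i).trans (bestAlloc_mem k _).2

theorem levelAlloc_of_level_zero {l : Fin n → Fin 3} {i : Fin n} (h : l i = 0) :
    levelAlloc k e l i = 0 := by
  simp [levelAlloc, h]

theorem levelWeight_update (l : Fin n → Fin 3) (i : Fin n) (a : Fin 3) :
    levelWeight k e (Function.update l i a)
      = Function.update (levelWeight k e l) i
        (if a = 2 then 1 / 2 else if a = 1 then max (e i / (2 * (k + e i))) 0 else 0) := by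
  ext j
  by_cases h : j = i
  · subst h; simp [levelWeight]
  · simp [levelWeight, h]

variable {k e}

/-- For e i > 0 the weight rises strictly from e/(2(k+e)) to 1/2; otherwise level 1 is served
nothing. -/
theorem levelAlloc_mono (hk : 1 ≤ k) (l : Fin n → Fin 3) (i : Fin n) :
    levelAlloc k e (Function.update l i 1) i ≤ levelAlloc k e (Function.update l i 2) i := by
  by_cases h : 0 < e i
  · simp only [levelAlloc, Function.update_self, if_true, h, and_true,
      show (1 : Fin 3) ≠ 2 by decide, if_false]
    rw [levelWeight_update, levelWeight_update]
    apply bestAlloc_update_mono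
    have hk' : (1 : ℝ) ≤ k := by exact_mod_cast hk
    simp only [show (1 : Fin 3) ≠ 2 by decide, if_true, if_false]
    refine max_lt ?_ (by norm_num)
    rw [div_lt_iff₀ (by linarith)]
    linarith
  · have : levelAlloc k e (Function.update l i 1) i = 0 := by
      simp [levelAlloc, h]
    rw [this]
    exact levelAlloc_nonneg k e _ i

theorem bidLevels_update {i : Fin n} (hi : ¬ (i : ℕ) < k) (v : Fin n → ℝ) (b : ℝ) :
    bidLevels k (Function.update v i b) = Function.update (bidLevels k v) i (valueLevel b) := by
  ext1 j
  by_cases h : j = i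
  · subst h; simp [bidLevels, hi]
  · simp [bidLevels, h]

theorem bidLevels_update_base {i : Fin n} (hi : (i : ℕ) < k) (v : Fin n → ℝ) (b : ℝ) :
    bidLevels k (Function.update v i b) = bidLevels k v := by
  ext1 j
  by_cases h : j = i
  · subst h; simp [bidLevels, hi]
  · simp [bidLevels, h]

theorem measurable_bidLevels : Measurable (bidLevels k : (Fin n → ℝ) → Fin n → Fin 3) := by
  rw [measurable_pi_iff]
  intro i
  unfold bidLevels
  split_ifs
  · exact measurable_const
  · exact (Measurable.ite measurableSet_Ici measurable_const
      (Measurable.ite measurableSet_Ici measurable_const measurable_const) :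
        Measurable valueLevel).comp (measurable_pi_apply i)

/-- This is the purpose of levels: they take finitely many values, so the arbitrary choice of
maximizer in `bestAlloc` causes no measurability problem. -/
theorem measurable_comp_bidLevels (f : (Fin n → Fin 3) → ℝ) :
    Measurable fun b : Fin n → ℝ => f (bidLevels k b) :=
  (Measurable.of_discrete (f := f)).comp measurable_bidLevels

variable (k e)

/-- Allocation of the reference mechanism: the best allocation by excess virtual values, with the
remaining units shared equally by the base bidders. -/
noncomputable def refAlloc (b : Fin n → ℝ) (i : Fin n) : ℝ :=
  if (i : ℕ) < k then
    if 1 / 2 ≤ b i then (k - ∑ j, levelAlloc k e (bidLevels k b) j) / k else 0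
  else levelAlloc k e (bidLevels k b) i

/-- Payments of the reference mechanism. -/
noncomputable def refPay (b : Fin n → ℝ) (i : Fin n) : ℝ :=
  if (i : ℕ) < k then 1 / 2 * refAlloc k e b i else levelPay k e (bidLevels k b) i

theorem refAlloc_mem_Icc (b : Fin n → ℝ) (i : Fin n) : refAlloc k e b i ∈ Set.Icc (0 : ℝ) 1 := by
  have h1 := sum_levelAlloc_le k e (bidLevels k b)
  have h2 : 0 ≤ ∑ j, levelAlloc k e (bidLevels k b) j :=
    Finset.sum_nonneg fun j _ => levelAlloc_nonneg k e _ j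
  unfold refAlloc
  split_ifs
  · exact ⟨div_nonneg (by linarith) (by positivity),
      div_le_one_of_le₀ (by linarith) (by positivity)⟩
  · simp
  · exact ⟨levelAlloc_nonneg k e _ i, levelAlloc_le_one k e _ i⟩

theorem sum_ite_base (hkn : k ≤ n) (c : ℝ) :
    ∑ i : Fin n, (if (i : ℕ) < k then c else 0) = k * c := by
  rw [Finset.sum_ite, Finset.sum_const_zero, add_zero, Finset.sum_const, nsmul_eq_mul,
    Fin.card_filter_val_lt, min_eq_right hkn]

theorem sum_refAlloc_le (hk : 1 ≤ k) (hkn : k ≤ n) (b : Fin n → ℝ) :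
    ∑ i, refAlloc k e b i ≤ k := by
  have hk' : (0 : ℝ) < k := by exact_mod_cast hk
  set S := ∑ j, levelAlloc k e (bidLevels k b) j with hS
  have h1 : S ≤ k := sum_levelAlloc_le k e _
  have h2 : ∀ i, refAlloc k e b i
      ≤ (if (i : ℕ) < k then (k - S) / k else 0) + levelAlloc k e (bidLevels k b) i := by
    intro i
    have := levelAlloc_nonneg k e (bidLevels k b) i
    have : 0 ≤ (k - S) / k := div_nonneg (by linarith) hk'.le
    unfold refAlloc
    split_ifs <;> linarith
  refine (Finset.sum_le_sum fun i _ => h2 i).trans ?_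
  rw [Finset.sum_add_distrib, sum_ite_base k hkn, ← hS]
  field_simp
  linarith

theorem measurable_refAlloc (i : Fin n) : Measurable fun b => refAlloc k e b i := by
  unfold refAlloc
  split_ifs
  · exact Measurable.ite (measurableSet_le measurable_const (measurable_pi_apply i))
      (measurable_comp_bidLevels fun l => (k - ∑ j, levelAlloc k e l j) / k) measurable_const
  · exact measurable_comp_bidLevels fun l => levelAlloc k e l i

theorem measurable_refPay (i : Fin n) : Measurable fun b => refPay k e b i := by
  unfold refPay
  split_ifs
  · exact (measurable_refAlloc k e i).const_mul _
  · exact measurable_comp_bidLevels fun l => levelPay k e l i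

theorem abs_refPay_le (b : Fin n → ℝ) (i : Fin n) : |refPay k e b i| ≤ 1 := by
  obtain ⟨h1, h2⟩ := refAlloc_mem_Icc k e b i
  have h3 := levelAlloc_nonneg k e (bidLevels k b) i
  have h4 := levelAlloc_le_one k e (bidLevels k b) i
  have h5 := levelAlloc_nonneg k e (Function.update (bidLevels k b) i 1) i
  have h6 := levelAlloc_le_one k e (Function.update (bidLevels k b) i 1) i
  rw [abs_le]
  unfold refPay levelPay
  split_ifs <;> constructor <;> linarith

/-- A revenue-optimal mechanism for the hard family. -/
noncomputable def refMechanism (hk : 1 ≤ k) (hkn : k ≤ n) : Mechanism n k where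
  alloc := refAlloc k e
  pay := refPay k e
  measurable_alloc := measurable_refAlloc k e
  measurable_pay := measurable_refPay k e
  alloc_nonneg b _ i := (refAlloc_mem_Icc k e b i).1
  alloc_le_one b _ i := (refAlloc_mem_Icc k e b i).2
  sum_alloc_le b _ := sum_refAlloc_le k e hk hkn b

theorem ref_update_high {i : Fin n} (hi : ¬ (i : ℕ) < k) (v : Fin n → ℝ) {b : ℝ} (hb : 1 ≤ b) :
    refAlloc k e (Function.update v i b) i
        = levelAlloc k e (Function.update (bidLevels k v) i 2) i ∧
      refPay k e (Function.update v i b) i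
        = levelAlloc k e (Function.update (bidLevels k v) i 2) i
          - 1 / 4 * levelAlloc k e (Function.update (bidLevels k v) i 1) i := by
  have hl : valueLevel b = 2 := if_pos hb
  simp [refAlloc, refPay, levelPay, hi, bidLevels_update hi, hl]

theorem ref_update_mid {i : Fin n} (hi : ¬ (i : ℕ) < k) (v : Fin n → ℝ) {b : ℝ}
    (hb : 3 / 4 ≤ b) (hb' : b < 1) :
    refAlloc k e (Function.update v i b) i
        = levelAlloc k e (Function.update (bidLevels k v) i 1) i ∧
      refPay k e (Function.update v i b) i
        = 3 / 4 * levelAlloc k e (Function.update (bidLevels k v) i 1) i := by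
  have hl : valueLevel b = 1 := by rw [valueLevel, if_neg hb'.not_ge, if_pos hb]
  simp [refAlloc, refPay, levelPay, hi, bidLevels_update hi, hl]

theorem ref_update_low {i : Fin n} (hi : ¬ (i : ℕ) < k) (v : Fin n → ℝ) {b : ℝ}
    (hb : b < 3 / 4) :
    refAlloc k e (Function.update v i b) i = 0 ∧ refPay k e (Function.update v i b) i = 0 := by
  have hl : valueLevel b = 0 := by
    rw [valueLevel, if_neg (by linarith), if_neg hb.not_ge]
  have h0 : levelAlloc k e (Function.update (bidLevels k v) i 0) i = 0 :=
    levelAlloc_of_level_zero k e (by simp)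
  simp [refAlloc, refPay, levelPay, hi, bidLevels_update hi, hl, h0]

/-- Incentives hold profile by profile, hence under every product law. A base bidder faces a posted
price 1/2 for a share independent of her bid. Any other bidder pays 3/4 for the share of level 1 and
1 for the nonnegative increment at level 2. -/
theorem refUtility_le (hk : 1 ≤ k) (i : Fin n) (v : Fin n → ℝ) (t b : ℝ) :
    t * refAlloc k e (Function.update v i b) i - refPay k e (Function.update v i b) i
      ≤ t * refAlloc k e (Function.update v i t) i - refPay k e (Function.update v i t) i := by
  by_cases hi : (i : ℕ) < k
  · have h1 := sum_levelAlloc_le k e (bidLevels k v)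
    have h2 : 0 ≤ (k - ∑ j, levelAlloc k e (bidLevels k v) j) / k :=
      div_nonneg (by linarith) (by positivity)
    simp only [refPay, refAlloc, hi, if_true, bidLevels_update_base hi, Function.update_self]
    split_ifs <;> nlinarith
  · have h1 := levelAlloc_mono (e := e) hk (bidLevels k v) i
    have h2 := levelAlloc_nonneg k e (Function.update (bidLevels k v) i 1) i
    have hval : ∀ s, (1 ≤ s ∨ (3 / 4 ≤ s ∧ s < 1)) ∨ s < (3 / 4 : ℝ) := fun s => by
      rcases le_or_gt 1 s with h | h
      · exact .inl (.inl h)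
      · rcases le_or_gt (3 / 4) s with h' | h'
        · exact .inl (.inr ⟨h', h⟩)
        · exact .inr h'
    rcases hval b with (hb | hb) | hb <;> rcases hval t with (ht | ht) | ht <;>
    · first
        | rw [(ref_update_high k e hi v hb).1, (ref_update_high k e hi v hb).2]
        | rw [(ref_update_mid k e hi v hb.1 hb.2).1, (ref_update_mid k e hi v hb.1 hb.2).2]
        | rw [(ref_update_low k e hi v hb).1, (ref_update_low k e hi v hb).2]
      (first
        | rw [(ref_update_high k e hi v ht).1, (ref_update_high k e hi v ht).2]
        | rw [(ref_update_mid k e hi v ht.1 ht.2).1, (ref_update_mid k e hi v ht.1 ht.2).2]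
        | rw [(ref_update_low k e hi v ht).1, (ref_update_low k e hi v ht).2]) <;>
      nlinarith

theorem refUtility_nonneg (hk : 1 ≤ k) (i : Fin n) (v : Fin n → ℝ) (t : ℝ) :
    0 ≤ t * refAlloc k e (Function.update v i t) i - refPay k e (Function.update v i t) i := by
  -- Bidding 0 gives utility zero.
  refine le_trans (le_of_eq ?_) (refUtility_le k e hk i v t 0)
  by_cases hi : (i : ℕ) < k
  · have : ¬ (1 / 2 : ℝ) ≤ 0 := by norm_num
    simp only [refPay, refAlloc, hi, if_true, Function.update_self, this, if_false]
    ring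
  · rw [(ref_update_low k e hi v (by norm_num)).1, (ref_update_low k e hi v (by norm_num)).2]
    ring

theorem isBIC_refMechanism (hk : 1 ≤ k) (hkn : k ≤ n)
    (D : Fin n → Measure ℝ) [∀ i, IsProbabilityMeasure (D i)] :
    IsBIC (refMechanism k e hk hkn) D := by
  have := isProbabilityMeasure_valueLaw D
  have hpay : ∀ i, Integrable (fun v => refPay k e v i) (valueLaw D) := fun i =>
    Integrable.of_bound (measurable_refPay k e i).aestronglyMeasurable 1
      (Filter.Eventually.of_forall fun v => abs_refPay_le k e v i)
  have hpay' : ∀ i b, Integrable (fun v => refPay k e (Function.update v i b) i) (valueLaw D) :=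
    fun i b => Integrable.of_bound ((measurable_refPay k e i).comp
      (measurable_update_const (X := fun _ => ℝ) i b)).aestronglyMeasurable 1
      (Filter.Eventually.of_forall fun v => abs_refPay_le k e _ i)
  have halloc' : ∀ i b, Integrable (fun v => refAlloc k e (Function.update v i b) i) (valueLaw D) :=
    fun i b => Integrable.of_bound ((measurable_refAlloc k e i).comp
      (measurable_update_const (X := fun _ => ℝ) i b)).aestronglyMeasurable 1
      (Filter.Eventually.of_forall fun v => by
        obtain ⟨h1, h2⟩ := refAlloc_mem_Icc k e (Function.update v i b) i
        simpa [abs_of_nonneg h1] using h2)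
  refine ⟨hpay, fun i b _ => hpay' i b, fun i t b _ _ => ?_, fun i t _ => ?_⟩
  · exact integral_mono (((halloc' i b).const_mul t).sub (hpay' i b))
      (((halloc' i t).const_mul t).sub (hpay' i t)) fun v => refUtility_le k e hk i v t b
  · exact integral_nonneg fun v => refUtility_nonneg k e hk i v t

end ReferenceMechanism

/-! ### Revenue of the reference mechanism. -/

section ReferenceRevenue

variable {n k : ℕ} {e : Fin n → ℝ}

theorem integrable_comp_bidLevels (μ : Measure (Fin n → ℝ)) [IsProbabilityMeasure μ]
    (f : (Fin n → Fin 3) → ℝ) : Integrable (fun v => f (bidLevels k v)) μ := by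
  obtain ⟨B, hB⟩ := (Set.finite_range fun l => |f l|).bddAbove
  exact Integrable.of_bound (measurable_comp_bidLevels f).aestronglyMeasurable B
    (Filter.Eventually.of_forall fun v => hB ⟨_, rfl⟩)

theorem integrable_refAlloc (μ : Measure (Fin n → ℝ)) [IsProbabilityMeasure μ] (i : Fin n) :
    Integrable (fun v => refAlloc k e v i) μ :=
  Integrable.of_bound (measurable_refAlloc k e i).aestronglyMeasurable 1
    (Filter.Eventually.of_forall fun v => by
      obtain ⟨h1, h2⟩ := refAlloc_mem_Icc k e v i
      simpa [abs_of_nonneg h1] using h2)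

theorem integrable_refPay (μ : Measure (Fin n → ℝ)) [IsProbabilityMeasure μ] (i : Fin n) :
    Integrable (fun v => refPay k e v i) μ :=
  Integrable.of_bound (measurable_refPay k e i).aestronglyMeasurable 1
    (Filter.Eventually.of_forall fun v => abs_refPay_le k e v i)

/-- Equality case of `IsBIC.integral_pay_nonbase_le`: the payments make rationality at the lowest
value and both adjacent constraints bind. -/
theorem integral_refPay (hk : 1 ≤ k) (hn : 2 * k ≤ n) (he : ∀ i, |e i| < k) (i : Fin n) :
    ∫ v, refPay k e v i ∂(valueLaw (hardProfile n k e))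
      = 1 / 2 * ∫ v, refAlloc k e v i ∂(valueLaw (hardProfile n k e))
        + ∫ v, excessWeight k e i (v i) * refAlloc k e v i
          ∂(valueLaw (hardProfile n k e)) := by
  have := isProbabilityMeasure_hardProfile hk hn he
  have hμ := isProbabilityMeasure_valueLaw (hardProfile n k e)
  by_cases hi : (i : ℕ) < k
  · simp [refPay, hi, excessWeight_base hi, integral_const_mul]
  · have hn0 : (n : ℝ) ≠ 0 := by
      have : 0 < n := by omega
      positivity
    have hA : Integrable (fun v => levelAlloc k e (Function.update (bidLevels k v) i 1) i)
        (valueLaw (hardProfile n k e)) :=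
      integrable_comp_bidLevels _ fun l => levelAlloc k e (Function.update l i 1) i
    have hC : Integrable (fun v => levelAlloc k e (Function.update (bidLevels k v) i 2) i)
        (valueLaw (hardProfile n k e)) :=
      integrable_comp_bidLevels _ fun l => levelAlloc k e (Function.update l i 2) i
    rw [integral_hardProfile_nonbase hk hn he hi (integrable_refPay _ i),
      integral_hardProfile_nonbase hk hn he hi (integrable_refAlloc _ i),
      integral_excessWeight_mul hk hn he hi (integrable_refAlloc _ i)]
    simp only [(ref_update_high k e hi _ le_rfl).1, (ref_update_high k e hi _ le_rfl).2,
      (ref_update_mid k e hi _ le_rfl (by norm_num)).1,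
      (ref_update_mid k e hi _ le_rfl (by norm_num)).2,
      (ref_update_low k e hi _ (lowValue_lt hk hn)).1,
      (ref_update_low k e hi _ (lowValue_lt hk hn)).2]
    rw [integral_sub hC (hA.const_mul _), integral_const_mul, integral_const_mul]
    simp only [integral_zero, mul_zero]
    field_simp
    ring

/-- Base values are almost surely 1/2, so base bidders absorb every unsold unit; this makes the k/2
term of the upper bound exact. -/
theorem ae_sum_refAlloc_eq (hk : 1 ≤ k) (hn : 2 * k ≤ n) (he : ∀ i, |e i| < k) :
    ∀ᵐ v ∂(valueLaw (hardProfile n k e)), ∑ i, refAlloc k e v i = k := by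
  have := isProbabilityMeasure_hardProfile hk hn he
  have hbase : ∀ i : Fin n, ∀ᵐ v ∂(valueLaw (hardProfile n k e)), (i : ℕ) < k → v i = 1 / 2 := by
    intro i
    by_cases hi : (i : ℕ) < k
    · have h : ∀ᵐ x ∂(hardProfile n k e i), x = 1 / 2 := by
        rw [hardProfile, if_pos hi, baseDist, ae_dirac_eq]; rfl
      filter_upwards [(Measure.tendsto_eval_ae_ae (μ := hardProfile n k e) (i := i)).eventually h]
        with v hv _ using hv
    · exact Filter.Eventually.of_forall fun v h => absurd h hi
  filter_upwards [ae_all_iff.2 hbase] with v hv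
  have h : ∀ i, refAlloc k e v i
      = (if (i : ℕ) < k then (k - ∑ j, levelAlloc k e (bidLevels k v) j) / k else 0)
        + levelAlloc k e (bidLevels k v) i := by
    intro i
    by_cases hi : (i : ℕ) < k
    · have h0 : levelAlloc k e (bidLevels k v) i = 0 :=
        levelAlloc_of_level_zero k e (by simp [bidLevels, hi])
      simp [refAlloc, hi, hv i hi, h0]
    · simp [refAlloc, hi]
  have hk' : (k : ℝ) ≠ 0 := by positivity
  rw [Finset.sum_congr rfl fun i _ => h i, Finset.sum_add_distrib, sum_ite_base k (by omega)]
  field_simp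
  ring

theorem revenue_refMechanism (hk : 1 ≤ k) (hn : 2 * k ≤ n) (hkn : k ≤ n)
    (he : ∀ i, |e i| < k) :
    revenue (refMechanism k e hk hkn) (hardProfile n k e)
      = k / 2 + ∫ v, ∑ i, excessWeight k e i (v i) * refAlloc k e v i
          ∂(valueLaw (hardProfile n k e)) := by
  have := isProbabilityMeasure_hardProfile hk hn he
  have hμ := isProbabilityMeasure_valueLaw (hardProfile n k e)
  have hsum : ∑ i, ∫ v, refAlloc k e v i ∂(valueLaw (hardProfile n k e)) = k := by
    rw [← integral_finsetSum _ fun i _ => integrable_refAlloc _ i,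
      integral_congr_ae (ae_sum_refAlloc_eq hk hn he)]
    simp
  have hrev : revenue (refMechanism k e hk hkn) (hardProfile n k e)
      = ∑ i, ∫ v, refPay k e v i ∂(valueLaw (hardProfile n k e)) :=
    integral_finsetSum _ fun i _ => integrable_refPay _ i
  rw [hrev, integral_finsetSum _ fun i _ => integrable_excessWeight_mul i (integrable_refAlloc _ i),
    Finset.sum_congr rfl fun i _ => integral_refPay hk hn he i, Finset.sum_add_distrib,
    ← Finset.mul_sum, hsum]
  ring

end ReferenceRevenue

/-! ### Pointwise loss of an arbitrary allocation. -/

section Loss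

variable {n k : ℕ} {e : Fin n → ℝ}

/-- The number of bidders other than base bidders who bid at least `3/4`. -/
noncomputable def activeCount (k : ℕ) (v : Fin n → ℝ) : ℕ :=
  (Finset.univ.filter fun i => bidLevels k v i ≠ 0).card

/-- Loss per unit of excess weight when a bidder with value in `[3/4, 1)` is allocated `a`. -/
noncomputable def lossFactor (k : ℕ) (e : Fin n → ℝ) (i : Fin n) (v : Fin n → ℝ) (a : ℝ) : ℝ :=
  if 0 < e i then (if activeCount k v ≤ k then 1 - a else 0) else -a

/-- The excess weight restricted to values in `[3/4, 1)`. -/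
noncomputable def midWeight (k : ℕ) (e : Fin n → ℝ) (i : Fin n) (v : ℝ) : ℝ :=
  if v < 1 then excessWeight k e i v else 0

theorem max_delta_of_pos (hk : 1 ≤ k) {x : ℝ} (h : 0 < x) :
    max (x / (2 * (k + x))) 0 = x / (2 * (k + x)) :=
  max_eq_left (by positivity)

theorem delta_nonpos {x : ℝ} (hx : |x| < k) (h : x ≤ 0) : x / (2 * (k + x)) ≤ 0 :=
  div_nonpos_of_nonpos_of_nonneg h (by linarith [add_pos_of_abs_lt hx])

/-- The right side is the maximum total of the positive-part weights, so one feasible competitor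
suffices, compared term by term: serve every active bidder if there are at most k of them, and
otherwise take x itself, since then no loss is charged for e i > 0. -/
theorem sum_excessWeight_add_loss_le (hk : 1 ≤ k) (he : ∀ i, |e i| < k) (v x : Fin n → ℝ)
    (hx : x ∈ feasibleAllocs n k) :
    ∑ i, excessWeight k e i (v i) * x i + ∑ i, midWeight k e i (v i) * lossFactor k e i v (x i)
      ≤ ∑ i, excessWeight k e i (v i) * refAlloc k e v i := by
  set w := levelWeight k e (bidLevels k v) with hw
  -- Wherever `refAlloc` may depart from `bestAlloc`, the weight w i vanishes, and so does either
  -- the excess weight or `refAlloc`.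
  have hbest : ∀ i, excessWeight k e i (v i) * refAlloc k e v i = w i * bestAlloc k w i := by
    intro i
    by_cases hi : (i : ℕ) < k
    · simp [excessWeight_base hi, hw, levelWeight, bidLevels, hi]
    rcases le_or_gt 1 (v i) with h1 | h1
    · have hl : bidLevels k v i = 2 := by simp [bidLevels, hi, valueLevel, h1]
      simp [excessWeight_high hi h1, refAlloc, hi, levelAlloc, hl, hw, levelWeight]
    rcases le_or_gt (3 / 4) (v i) with h2 | h2
    · have hl : bidLevels k v i = 1 := by simp [bidLevels, hi, valueLevel, h1.not_ge, h2]
      by_cases h0 : 0 < e i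
      · simp [excessWeight_mid hi h2 h1, refAlloc, hi, levelAlloc, hl, hw, levelWeight, h0,
          max_delta_of_pos hk h0]
      · simp [refAlloc, hi, levelAlloc, hl, hw, levelWeight, h0,
          max_eq_right (delta_nonpos (he i) (not_lt.1 h0))]
    · have hl : bidLevels k v i = 0 := by
        simp [bidLevels, hi, valueLevel, h1.not_ge, h2.not_ge]
      simp [excessWeight_low h2, hw, levelWeight, hl]
  simp_rw [hbest]
  rw [← Finset.sum_add_distrib]
  by_cases hN : activeCount k v ≤ k
  · have hy : (fun i => if bidLevels k v i ≠ 0 then (1 : ℝ) else 0) ∈ feasibleAllocs n k := by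
      refine ⟨fun i => by dsimp only; split_ifs <;> norm_num, ?_⟩
      rw [Finset.sum_boole]
      exact_mod_cast hN
    refine le_trans (Finset.sum_le_sum fun i _ => ?_) (le_bestAlloc w hy)
    obtain ⟨hx0, hx1⟩ := hx.1 i
    by_cases hi : (i : ℕ) < k
    · simp [excessWeight_base hi, hw, levelWeight, bidLevels, hi, midWeight]
    rcases le_or_gt 1 (v i) with h1 | h1
    · have hl : bidLevels k v i = 2 := by simp [bidLevels, hi, valueLevel, h1]
      simp [excessWeight_high hi h1, hl, hw, levelWeight, midWeight, h1.not_gt, hx1]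
    rcases le_or_gt (3 / 4) (v i) with h2 | h2
    · have hl : bidLevels k v i = 1 := by simp [bidLevels, hi, valueLevel, h1.not_ge, h2]
      by_cases h0 : 0 < e i
      · simp only [excessWeight_mid hi h2 h1, midWeight, h1, lossFactor, h0, hN, hl, hw,
          levelWeight, max_delta_of_pos hk h0, if_true]
        simp only [show (1 : Fin 3) ≠ 2 by decide, show (1 : Fin 3) ≠ 0 by decide, if_false,
          if_true, ne_eq, not_false_eq_true]
        linarith
      · simp [excessWeight_mid hi h2 h1, midWeight, h1, lossFactor, h0, hl, hw, levelWeight]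
    · have hl : bidLevels k v i = 0 := by
        simp [bidLevels, hi, valueLevel, h1.not_ge, h2.not_ge]
      simp [excessWeight_low h2, midWeight, hl]
  · refine le_trans (Finset.sum_le_sum fun i _ => ?_) (le_bestAlloc w hx)
    obtain ⟨hx0, hx1⟩ := hx.1 i
    by_cases hi : (i : ℕ) < k
    · simp [excessWeight_base hi, hw, levelWeight, bidLevels, hi, midWeight]
    rcases le_or_gt 1 (v i) with h1 | h1
    · have hl : bidLevels k v i = 2 := by simp [bidLevels, hi, valueLevel, h1]
      simp [excessWeight_high hi h1, hl, hw, levelWeight, midWeight, h1.not_gt]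
    rcases le_or_gt (3 / 4) (v i) with h2 | h2
    · have hl : bidLevels k v i = 1 := by simp [bidLevels, hi, valueLevel, h1.not_ge, h2]
      by_cases h0 : 0 < e i
      · simp [excessWeight_mid hi h2 h1, midWeight, h1, lossFactor, h0, hN, hl, hw,
          levelWeight, max_delta_of_pos hk h0]
      · simp only [excessWeight_mid hi h2 h1, midWeight, h1, lossFactor, h0, if_true, if_false]
        have : 0 ≤ w i * x i := mul_nonneg (by simp [hw, levelWeight, hl]) hx0
        linarith
    · have hl : bidLevels k v i = 0 := by
        simp [bidLevels, hi, valueLevel, h1.not_ge, h2.not_ge]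
      simp [excessWeight_low h2, midWeight, hw, levelWeight, hl]

theorem midWeight_mul_lossFactor_nonneg (he : ∀ i, |e i| < k) (i : Fin n)
    (v : Fin n → ℝ) {a : ℝ} (ha0 : 0 ≤ a) (ha1 : a ≤ 1) :
    0 ≤ midWeight k e i (v i) * lossFactor k e i v a := by
  by_cases hi : (i : ℕ) < k
  · simp [midWeight, excessWeight_base hi]
  rcases le_or_gt 1 (v i) with h1 | h1
  · simp [midWeight, h1.not_gt]
  rcases le_or_gt (3 / 4) (v i) with h2 | h2
  · rw [midWeight, if_pos h1, excessWeight_mid hi h2 h1, lossFactor]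
    split_ifs with h0 hN
    · exact mul_nonneg (by positivity) (by linarith)
    · simp
    · exact mul_nonneg_of_nonpos_of_nonpos (delta_nonpos (he i) (not_lt.1 h0)) (by linarith)
  · simp [midWeight, excessWeight_low h2]

end Loss

/-! ### Expected loss and the number of misallocated bidders. -/

section LossBound

variable {n k : ℕ} {e : Fin n → ℝ}

theorem integrable_midWeight_mul (i : Fin n) {μ : Measure (Fin n → ℝ)}
    {f : (Fin n → ℝ) → ℝ} (hf : Integrable f μ) :
    Integrable (fun v => midWeight k e i (v i) * f v) μ := by
  obtain ⟨B, hB0, hB⟩ := exists_abs_excessWeight_le (k := k) e i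
  have hm : Measurable (midWeight k e i) :=
    Measurable.ite measurableSet_Iio (measurable_excessWeight e i) measurable_const
  refine hf.bdd_mul (hm.comp (measurable_pi_apply i)).aestronglyMeasurable
    (c := B) (Filter.Eventually.of_forall fun v => ?_)
  simp only [midWeight]
  split_ifs
  · exact hB (v i)
  · simpa using hB0

/-- The mass (k+e)/(4n) of 3/4 times the excess e/(2(k+e)) is e/(8n). -/
theorem integral_midWeight_mul (hk : 1 ≤ k) (hn : 2 * k ≤ n)
    (he : ∀ i, |e i| < k) {i : Fin n} (hi : ¬ (i : ℕ) < k) {f : (Fin n → ℝ) → ℝ}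
    (hf : Integrable f (valueLaw (hardProfile n k e))) :
    ∫ v, midWeight k e i (v i) * f v ∂(valueLaw (hardProfile n k e))
      = e i / (8 * n) * ∫ v, f (Function.update v i (3 / 4))
          ∂(valueLaw (hardProfile n k e)) := by
  have hn0 : (n : ℝ) ≠ 0 := by
    have : 0 < n := by omega
    positivity
  have hke := add_pos_of_abs_lt (he i)
  have h3 := lowValue_lt hk hn
  rw [integral_hardProfile_nonbase hk hn he hi (integrable_midWeight_mul i hf)]
  simp only [Function.update_self, midWeight, lt_irrefl, if_false, excessWeight_low h3,
    excessWeight_mid hi (le_refl (3 / 4 : ℝ)) (by norm_num), ite_self,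
    show (3 / 4 : ℝ) < 1 by norm_num, if_true, integral_const_mul, zero_mul, mul_zero,
    integral_zero]
  field_simp
  ring

theorem activeCount_update_le (v : Fin n → ℝ) (i : Fin n) (b : ℝ) :
    activeCount k (Function.update v i b) ≤ activeCount k v + 1 := by
  unfold activeCount
  refine (Finset.card_le_card fun j hj => ?_).trans
    (Finset.card_insert_le i (Finset.univ.filter fun i => bidLevels k v i ≠ 0))
  by_cases h : j = i
  · simp [h]
  · simpa [h, bidLevels] using hj

theorem integrable_activeCount (μ : Measure (Fin n → ℝ)) [IsProbabilityMeasure μ] :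
    Integrable (fun v => (activeCount k v : ℝ)) μ :=
  integrable_comp_bidLevels μ fun l => ((Finset.univ.filter fun i => l i ≠ 0).card : ℝ)

theorem integral_activeCount_le (hk : 1 ≤ k) (hn : 2 * k ≤ n) (he : ∀ i, |e i| < k) :
    ∫ v, (activeCount k v : ℝ) ∂(valueLaw (hardProfile n k e)) ≤ k / 2 := by
  have := isProbabilityMeasure_hardProfile hk hn he
  have hμ := isProbabilityMeasure_valueLaw (hardProfile n k e)
  have hn0 : (0 : ℝ) < n := by
    have : 0 < n := by omega
    positivity
  have hint : ∀ i, Integrable (fun v => if bidLevels k v i ≠ 0 then (1 : ℝ) else 0)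
      (valueLaw (hardProfile n k e)) := fun i =>
    integrable_comp_bidLevels _ fun l => if l i ≠ 0 then (1 : ℝ) else 0
  have hle : ∀ i, ∫ v, (if bidLevels k v i ≠ 0 then (1 : ℝ) else 0)
      ∂(valueLaw (hardProfile n k e)) ≤ k / (2 * n) := by
    intro i
    by_cases hi : (i : ℕ) < k
    · simp only [bidLevels, hi, if_true, ne_eq, not_true_eq_false, if_false, integral_zero]
      positivity
    · have l3 : valueLevel (1 / 2 + k / (8 * n)) = 0 := by
        have := lowValue_lt hk hn
        rw [valueLevel, if_neg (by linarith), if_neg (by linarith)]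
      rw [integral_hardProfile_nonbase hk hn he hi (hint i)]
      simp only [bidLevels_update hi, Function.update_self, l3, ne_eq, not_true_eq_false, if_false,
        integral_zero, mul_zero, zero_add]
      have l2 : valueLevel (3 / 4) ≠ 0 := by
        rw [valueLevel, if_neg (by norm_num), if_pos le_rfl]; decide
      have l1 : valueLevel 1 ≠ 0 := by
        rw [valueLevel, if_pos le_rfl]; decide
      simp only [l2, l1, not_false_eq_true, if_true, integral_const, probReal_univ,
        smul_eq_mul, mul_one]
      apply le_of_eq
      field_simp
      ring
  have hsum : ∀ v : Fin n → ℝ, (activeCount k v : ℝ)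
      = ∑ i, if bidLevels k v i ≠ 0 then (1 : ℝ) else 0 := fun v => by
    rw [Finset.sum_boole, activeCount]
  simp_rw [hsum]
  rw [integral_finsetSum _ fun i _ => hint i]
  refine (Finset.sum_le_sum fun i _ => hle i).trans_eq ?_
  rw [Finset.sum_const, Finset.card_univ, Fintype.card_fin, nsmul_eq_mul]
  field_simp

theorem integrable_lossFactor (M : Mechanism n k) {D : Fin n → Measure ℝ}
    [∀ i, IsProbabilityMeasure (D i)] (hD : ∀ i, ∀ᵐ x ∂(D i), 0 ≤ x) (i : Fin n) :
    Integrable (fun v => lossFactor k e i v (M.alloc v i)) (valueLaw D) := by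
  have := isProbabilityMeasure_valueLaw D
  have hi := integrable_alloc M hD i
  unfold lossFactor
  split_ifs
  · have hs : MeasurableSet {v : Fin n → ℝ | activeCount k v ≤ k} :=
      measurable_bidLevels (Set.toFinite
        {l : Fin n → Fin 3 | (Finset.univ.filter fun i => l i ≠ 0).card ≤ k}).measurableSet
    have h := ((integrable_const (1 : ℝ)).sub hi).indicator hs
    refine h.congr (Filter.Eventually.of_forall fun v => ?_)
    by_cases hv : activeCount k v ≤ k
    · simp [hv]
    · simp [hv]
  · exact hi.neg

theorem integrable_lossFactor_update (M : Mechanism n k) {D : Fin n → Measure ℝ}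
    [∀ i, IsProbabilityMeasure (D i)] (hD : ∀ i, ∀ᵐ x ∂(D i), 0 ≤ x) (i : Fin n) {b : ℝ}
    (hb : 0 ≤ b) :
    Integrable (fun v => lossFactor k e i (Function.update v i b)
      (M.alloc (Function.update v i b) i)) (valueLaw D) := by
  have hp : ∀ j, IsProbabilityMeasure (Function.update D i (Measure.dirac b) j) :=
    isProbabilityMeasure_update i
  have hmap : (valueLaw D).map (fun v => Function.update v i b)
      = valueLaw (Function.update D i (Measure.dirac b)) := map_update_const_pi D i b
  have h := integrable_lossFactor (e := e) M (D := Function.update D i (Measure.dirac b))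
    (fun j => by
      by_cases h : j = i
      · subst h; rw [Function.update_self, ae_dirac_eq]; exact hb
      · rw [Function.update_of_ne h]; exact hD j) i
  rw [← hmap] at h
  exact h.comp_measurable (measurable_update_const (X := fun _ => ℝ) i b)

/-- Bidder `i` is treated at value `3/4` in the way that is wrong for the sign of `e i`. -/
def Misallocates (M : Mechanism n k) (D : Fin n → Measure ℝ) (e : Fin n → ℝ) (i : Fin n) : Prop :=
  if 0 < e i then interimAlloc M D i (3 / 4) < 1 / 4 else 1 / 4 ≤ interimAlloc M D i (3 / 4)

/-- If e i > 0, the ideal interim allocation at 3/4 is at least 1/2 by Markov, so the shortfall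
exceeds 1/4; if e i ≤ 0, every allocation at 3/4 is a loss. -/
theorem Misallocates.le_integral_loss (hk : 1 ≤ k) (hn : 2 * k ≤ n) (he : ∀ i, |e i| < k)
    {M : Mechanism n k} {i : Fin n} (hi : ¬ (i : ℕ) < k)
    (hM : Misallocates M (hardProfile n k e) e i) :
    |e i| / (32 * n) ≤ ∫ v, midWeight k e i (v i) * lossFactor k e i v (M.alloc v i)
      ∂(valueLaw (hardProfile n k e)) := by
  have := isProbabilityMeasure_hardProfile hk hn he
  have hμ := isProbabilityMeasure_valueLaw (hardProfile n k e)
  have hD := hardProfile_ae_nonneg (k := k) e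
  have hk0 : (0 : ℝ) < k := by positivity
  have hn0 : (0 : ℝ) < n := by
    have : 0 < n := by omega
    positivity
  have hX := integrable_alloc_update M hD i (b := 3 / 4) (by norm_num)
  rw [integral_midWeight_mul hk hn he hi (integrable_lossFactor M hD i)]
  by_cases h0 : 0 < e i
  · rw [Misallocates, if_pos h0, interimAlloc] at hM
    have hN := integral_activeCount_le hk hn he
    have hlow : 1 - (∫ v, (activeCount k v : ℝ) ∂(valueLaw (hardProfile n k e))) / k
        - ∫ v, M.alloc (Function.update v i (3 / 4)) i ∂(valueLaw (hardProfile n k e))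
        ≤ ∫ v, lossFactor k e i (Function.update v i (3 / 4))
          (M.alloc (Function.update v i (3 / 4)) i) ∂(valueLaw (hardProfile n k e)) := by
      have hNint : Integrable (fun v => 1 - (activeCount k v : ℝ) / k)
          (valueLaw (hardProfile n k e)) :=
        (integrable_const _).sub ((integrable_activeCount _).div_const _)
      have heq : 1 - (∫ v, (activeCount k v : ℝ) ∂(valueLaw (hardProfile n k e))) / k
        - ∫ v, M.alloc (Function.update v i (3 / 4)) i ∂(valueLaw (hardProfile n k e))
        = ∫ v, (1 - (activeCount k v : ℝ) / k - M.alloc (Function.update v i (3 / 4)) i)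
          ∂(valueLaw (hardProfile n k e)) := by
        rw [integral_sub hNint hX, integral_sub (integrable_const _)
          ((integrable_activeCount _).div_const _), integral_div]
        simp
      rw [heq]
      refine integral_mono_ae (hNint.sub hX)
        (integrable_lossFactor_update M hD i (by norm_num)) ?_
      filter_upwards [ae_nonneg_valueLaw hD] with v hv
      have ha0 := M.alloc_nonneg _ (update_nonneg hv i (by norm_num : (0 : ℝ) ≤ 3 / 4)) i
      rw [lossFactor, if_pos h0]
      split_ifs with hc
      · have : (0 : ℝ) ≤ (activeCount k v : ℝ) / k := by positivity
        linarith
      -- Placing i at 3/4 adds at most one active bidder, so exceeding k afterwards means at least k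
      -- before, where 1 - `activeCount`/k is nonpositive.
      · have h1 := activeCount_update_le (k := k) v i (3 / 4)
        have h2 : (k : ℝ) ≤ activeCount k v := by
          have : k ≤ activeCount k v := by omega
          exact_mod_cast this
        have : 1 ≤ (activeCount k v : ℝ) / k := by rwa [le_div_iff₀ hk0, one_mul]
        linarith
    have hN' : (∫ v, (activeCount k v : ℝ) ∂(valueLaw (hardProfile n k e))) / k ≤ 1 / 2 := by
      rw [div_le_iff₀ hk0]; linarith
    rw [abs_of_pos h0]
    calc e i / (32 * n) = e i / (8 * n) * (1 / 4) := by field_simp; norm_num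
      _ ≤ _ := mul_le_mul_of_nonneg_left (by linarith) (by positivity)
  · rw [Misallocates, if_neg h0, interimAlloc] at hM
    simp only [lossFactor, h0, if_false]
    rw [integral_neg, abs_of_nonpos (not_lt.1 h0)]
    have hq : 0 ≤ -e i / (8 * n) := div_nonneg (by linarith) (by positivity)
    calc -e i / (32 * n) = -e i / (8 * n) * (1 / 4) := by field_simp; ring
      _ ≤ -e i / (8 * n) * ∫ v, M.alloc (Function.update v i (3 / 4)) i
          ∂(valueLaw (hardProfile n k e)) := mul_le_mul_of_nonneg_left hM hq
      _ = _ := by ring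

theorem mem_feasibleAllocs (M : Mechanism n k) {v : Fin n → ℝ} (hv : 0 ≤ v) :
    M.alloc v ∈ feasibleAllocs n k :=
  ⟨fun i => ⟨M.alloc_nonneg v hv i, M.alloc_le_one v hv i⟩, M.sum_alloc_le v hv⟩

open scoped Classical in
-- The pointwise inequality is integrated; all losses are nonnegative, so only those of misallocated
-- bidders need be kept.
theorem IsBIC.revenue_add_loss_le (hk : 1 ≤ k) (hn : 2 * k ≤ n) (hkn : k ≤ n) {ε : ℝ}
    (hε : ε < k) (heε : ∀ i, |e i| = ε) {M : Mechanism n k}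
    (hM : IsBIC M (hardProfile n k e)) :
    revenue M (hardProfile n k e) + ε / (32 * n) *
      (Finset.univ.filter fun i : Fin n =>
        ¬ (i : ℕ) < k ∧ Misallocates M (hardProfile n k e) e i).card
      ≤ revenue (refMechanism k e hk hkn) (hardProfile n k e) := by
  have he : ∀ i, |e i| < k := fun i => (heε i).trans_lt hε
  have := isProbabilityMeasure_hardProfile hk hn he
  have hμ := isProbabilityMeasure_valueLaw (hardProfile n k e)
  have hD := hardProfile_ae_nonneg (k := k) e
  have hrev := hM.revenue_le hk hn he
  rw [revenue_refMechanism hk hn hkn he]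
  set L : Fin n → ℝ := fun i => ∫ v, midWeight k e i (v i) * lossFactor k e i v (M.alloc v i)
      ∂(valueLaw (hardProfile n k e)) with hL
  have hli := fun i => integrable_midWeight_mul (k := k) (e := e) i
    (integrable_lossFactor (e := e) M hD i)
  have hL0 : ∀ i, 0 ≤ L i := fun i => by
    refine integral_nonneg_of_ae ?_
    filter_upwards [ae_nonneg_valueLaw hD] with v hv
    exact midWeight_mul_lossFactor_nonneg he i v (M.alloc_nonneg v hv i) (M.alloc_le_one v hv i)
  have hcount : ε / (32 * n) * (Finset.univ.filter fun i : Fin n =>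
      ¬ (i : ℕ) < k ∧ Misallocates M (hardProfile n k e) e i).card ≤ ∑ i, L i := by
    rw [mul_comm, ← nsmul_eq_mul, ← Finset.sum_const]
    refine (Finset.sum_le_sum fun i hi => ?_).trans
      (Finset.sum_le_sum_of_subset_of_nonneg (Finset.filter_subset _ _) fun i _ _ => hL0 i)
    obtain ⟨h1, h2⟩ := (Finset.mem_filter.1 hi).2
    rw [← heε i]
    exact h2.le_integral_loss hk hn he h1
  have hxi : Integrable (fun v => ∑ i, excessWeight k e i (v i) * M.alloc v i)
      (valueLaw (hardProfile n k e)) :=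
    integrable_finsetSum _ fun i _ => integrable_excessWeight_mul i (integrable_alloc M hD i)
  have hmain : ∫ v, ∑ i, excessWeight k e i (v i) * M.alloc v i ∂(valueLaw (hardProfile n k e))
      + ∑ i, L i ≤ ∫ v, ∑ i, excessWeight k e i (v i) * refAlloc k e v i
          ∂(valueLaw (hardProfile n k e)) := by
    rw [← integral_finsetSum _ fun i _ => hli i,
      ← integral_add hxi (integrable_finsetSum _ fun i _ => hli i)]
    refine integral_mono_ae (hxi.add (integrable_finsetSum _ fun i _ => hli i))
      (integrable_finsetSum _ fun i _ => integrable_excessWeight_mul i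
        (integrable_refAlloc _ i)) ?_
    filter_upwards [ae_nonneg_valueLaw hD] with v hv
    exact sum_excessWeight_add_loss_le hk he v (M.alloc v) (mem_feasibleAllocs M hv)
  linarith

theorem revenue_refMechanism_le_optRevenue (hk : 1 ≤ k) (hn : 2 * k ≤ n) (hkn : k ≤ n) {ε : ℝ}
    (hε0 : 0 < ε) (hε : ε < k) (heε : ∀ i, |e i| = ε) :
    revenue (refMechanism k e hk hkn) (hardProfile n k e)
      ≤ optRevenue k (hardProfile n k e) := by
  have he : ∀ i, |e i| < k := fun i => (heε i).trans_lt hε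
  have := isProbabilityMeasure_hardProfile hk hn he
  -- The reference revenue itself bounds all BIC revenues, so the real `sSup` is a genuine supremum
  -- and not the default 0.
  refine le_csSup ⟨revenue (refMechanism k e hk hkn) (hardProfile n k e), ?_⟩
    ⟨_, isBIC_refMechanism k e hk hkn _, rfl⟩
  rintro _ ⟨M, hM, rfl⟩
  refine le_trans ?_ (hM.revenue_add_loss_le hk hn hkn hε heε)
  exact le_add_of_nonneg_right (by positivity)

open scoped Classical in
theorem card_misallocates_le (hk : 1 ≤ k) (hn : 2 * k ≤ n) {ε c : ℝ}
    (hε0 : 0 < ε) (hε : ε < k) (heε : ∀ i, |e i| = ε) {M : Mechanism n k}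
    (hM : IsBIC M (hardProfile n k e))
    (hrev : optRevenue k (hardProfile n k e) - c * ε ≤ revenue M (hardProfile n k e)) :
    ((Finset.univ.filter fun i : Fin n =>
      ¬ (i : ℕ) < k ∧ Misallocates M (hardProfile n k e) e i).card : ℝ) ≤ 32 * c * n := by
  have hkn : k ≤ n := by omega
  have hn0 : (0 : ℝ) < n := by
    have : 0 < n := by omega
    positivity
  have h1 := hM.revenue_add_loss_le hk hn hkn hε heε
  have h2 := revenue_refMechanism_le_optRevenue hk hn hkn hε0 hε heε
  have h3 : ε / (32 * n) * (Finset.univ.filter fun i : Fin n =>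
      ¬ (i : ℕ) < k ∧ Misallocates M (hardProfile n k e) e i).card ≤ c * ε := by linarith
  rw [div_mul_eq_mul_div, div_le_iff₀ (by positivity)] at h3
  nlinarith

end LossBound

/-! ### Assouad's argument over sign vectors. -/

section Assouad

variable {n k m : ℕ} {Ω : Type*} [MeasurableSpace Ω]

/-- The perturbations `ε` and `-ε` chosen by a sign vector. -/
def signs (ε : ℝ) (θ : Fin n → Bool) (i : Fin n) : ℝ := if θ i then ε else -ε

theorem abs_signs {ε : ℝ} (hε : 0 < ε) (θ : Fin n → Bool) (i : Fin n) : |signs ε θ i| = ε := by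
  unfold signs
  split_ifs <;> simp [hε.le]

/-- Flip the sign of coordinate `i`. -/
def flipAt (i : Fin n) (θ : Fin n → Bool) : Fin n → Bool := Function.update θ i (!θ i)

theorem flipAt_involutive (i : Fin n) : Function.Involutive (flipAt i) := fun θ => by
  simp [flipAt]

theorem signs_flipAt (ε : ℝ) (θ : Fin n → Bool) (i : Fin n) :
    signs ε (flipAt i θ) = Function.update (signs ε θ) i (-signs ε θ i) := by
  ext j
  by_cases h : j = i
  · subst h
    cases hj : θ j <;> simp [signs, flipAt, hj]
  · simp [signs, flipAt, h]

theorem hardProfile_update {e : Fin n → ℝ} {i : Fin n} (hi : ¬ (i : ℕ) < k) (x : ℝ) :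
    hardProfile n k (Function.update e i x)
      = Function.update (hardProfile n k e) i (highDist n k x) := by
  ext1 j
  by_cases h : j = i
  · subst h; simp [hardProfile, hi]
  · simp [hardProfile, h]

theorem hardProfile_mem_hardFamily (ε : ℝ) (θ : Fin n → Bool) :
    hardProfile n k (signs ε θ) ∈ hardFamily n k ε := by
  refine ⟨fun i hi => by simp [hardProfile, hi], fun i hi => ?_⟩
  rw [hardProfile, if_neg hi.not_gt, lowDist_eq_highDist_neg, signs]
  split_ifs
  · exact .inl rfl
  · exact .inr rfl

/-- The coordinate i is overwritten by the bid, so its law is irrelevant. Hence the test statistic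
is the same under both signs of e i. -/
theorem interimAlloc_update (M : Mechanism n k) (D : Fin n → Measure ℝ)
    [∀ i, IsProbabilityMeasure (D i)] (i : Fin n) (ν : Measure ℝ) [IsProbabilityMeasure ν]
    (b : ℝ) : interimAlloc M (Function.update D i ν) i b = interimAlloc M D i b := by
  have hp : ∀ j, IsProbabilityMeasure (Function.update D i ν j) := isProbabilityMeasure_update i
  have h : ∀ D' : Fin n → Measure ℝ, (∀ j, IsProbabilityMeasure (D' j)) →
      interimAlloc M D' i b
        = ∫ v, M.alloc v i ∂(Measure.pi (Function.update D' i (Measure.dirac b))) := by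
    intro D' hD'
    rw [← map_update_const_pi D' i b, integral_map
      (measurable_update_const (X := fun _ => ℝ) i b).aemeasurable
      (M.measurable_alloc i).aestronglyMeasurable]
    rfl
  rw [h _ hp, h D inferInstance, Function.update_idem]

/-- The event that the learned mechanism misallocates bidder `i`. -/
def misallocSet (A : LearningAlgorithm n k m Ω) (e : Fin n → ℝ) (i : Fin n) :
    Set ((Fin m → Fin n → ℝ) × Ω) :=
  {q | Misallocates (A.out q.1 q.2) (hardProfile n k e) e i}

theorem measurable_interimAlloc (A : LearningAlgorithm n k m Ω) (D : Fin n → Measure ℝ)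
    [∀ i, IsProbabilityMeasure (D i)] (i : Fin n) (b : ℝ) :
    Measurable fun q : (Fin m → Fin n → ℝ) × Ω => interimAlloc (A.out q.1 q.2) D i b := by
  have := isProbabilityMeasure_valueLaw D
  have h : Measurable fun p : ((Fin m → Fin n → ℝ) × Ω) × (Fin n → ℝ) =>
      (A.out p.1.1 p.1.2).alloc (Function.update p.2 i b) i :=
    (A.measurable_alloc i).comp (measurable_fst.prodMk
      ((measurable_update_const (X := fun _ => ℝ) i b).comp measurable_snd))
  exact h.stronglyMeasurable.integral_prod_right'.measurable

theorem measurableSet_misallocSet (A : LearningAlgorithm n k m Ω) {e : Fin n → ℝ}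
    (hp : ∀ i, IsProbabilityMeasure (hardProfile n k e i)) (i : Fin n) :
    MeasurableSet (misallocSet A e i) := by
  have h := measurable_interimAlloc A (hardProfile n k e) i (3 / 4)
  unfold misallocSet Misallocates
  split_ifs
  · exact measurableSet_lt h measurable_const
  · exact measurableSet_le measurable_const h

/-- One statistic and one threshold: the test errs under one sign exactly when it is right under the
other. -/
theorem misallocSet_flip (A : LearningAlgorithm n k m Ω) {e : Fin n → ℝ} {i : Fin n}
    (hi : ¬ (i : ℕ) < k) (hp : ∀ i, IsProbabilityMeasure (hardProfile n k e i))
    (hp' : IsProbabilityMeasure (highDist n k (-e i))) (he : e i ≠ 0) :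
    misallocSet A (Function.update e i (-e i)) i = (misallocSet A e i)ᶜ := by
  ext q
  simp only [misallocSet, Misallocates, Set.mem_ofPred_eq, Set.mem_compl_iff,
    Function.update_self, hardProfile_update hi, interimAlloc_update]
  rcases lt_or_gt_of_ne he with h | h
  · simp [h, h.not_gt]
  · simp [h, h.le]

theorem nine_tenths_le_flip_add (hk : 1 ≤ k) (hn : 2 * k ≤ n) {ε : ℝ} (hε0 : 0 < ε)
    (hε : ε < k) (hm : m * (ε ^ 2 / (2 * n * k)) ≤ 1 / 1000) (A : LearningAlgorithm n k m Ω)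
    (P : Measure Ω) [IsProbabilityMeasure P] (θ : Fin n → Bool) {i : Fin n}
    (hi : ¬ (i : ℕ) < k) :
    9 / 10 ≤ (runLaw m (hardProfile n k (signs ε θ)) P).real (misallocSet A (signs ε θ) i)
      + (runLaw m (hardProfile n k (signs ε (flipAt i θ))) P).real
        (misallocSet A (signs ε (flipAt i θ)) i) := by
  have he : ∀ θ : Fin n → Bool, ∀ i, |signs ε θ i| < k := fun θ i => by rwa [abs_signs hε0]
  have hp := isProbabilityMeasure_hardProfile hk hn (he θ)
  have hp' := isProbabilityMeasure_hardProfile hk hn (he (flipAt i θ))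
  have hpn : IsProbabilityMeasure (highDist n k (-signs ε θ i)) :=
    isProbabilityMeasure_highDist hk hn (by rw [abs_neg]; exact (he θ i).le)
  have hne : signs ε θ i ≠ 0 := by rw [← abs_pos, abs_signs hε0]; exact hε0
  have hmeas := measurableSet_misallocSet A hp i
  have hsq : signs ε θ i ^ 2 = ε ^ 2 := by rw [← sq_abs, abs_signs hε0]
  -- Applied to the complement of the error event and with perturbation `signs ε θ i`, so either
  -- initial sign is covered; it reads 1 - p - p' ≤ 1/10 for the two error probabilities.
  have key := runLaw_highDist_sub_le (m := m) hk hn (he θ i).le (by rwa [hsq])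
    (hardProfile n k (signs ε θ)) i P hmeas.compl
  have hr := isProbabilityMeasure_runLaw (m := m) (hardProfile n k (signs ε θ)) P
  have hself : Function.update (hardProfile n k (signs ε θ)) i (highDist n k (signs ε θ i))
      = hardProfile n k (signs ε θ) := by
    rw [← hardProfile_update hi, Function.update_eq_self]
  rw [hself, ← hardProfile_update hi, ← signs_flipAt, probReal_compl_eq_one_sub hmeas] at key
  rw [show misallocSet A (signs ε (flipAt i θ)) i = (misallocSet A (signs ε θ) i)ᶜ by
    rw [signs_flipAt, misallocSet_flip A hi hp hpn hne]]
  linarith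

/-- On success at most 32cn bidders are wrong; on failure, of probability at most 1/100, at most n
are. -/
theorem sum_misallocSet_le (hk : 1 ≤ k) (hn : 2 * k ≤ n) {ε c : ℝ} (hc : 0 ≤ c) (hε0 : 0 < ε)
    (hε : ε < k) (A : LearningAlgorithm n k m Ω) (P : Measure Ω) [IsProbabilityMeasure P]
    (θ : Fin n → Bool)
    (hA : 0.99 ≤ successProb A P (hardProfile n k (signs ε θ)) (c * ε)) :
    ∑ i ∈ Finset.univ.filter (fun i : Fin n => ¬ (i : ℕ) < k),
      (runLaw m (hardProfile n k (signs ε θ)) P).real (misallocSet A (signs ε θ) i)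
      ≤ 32 * c * n + n / 100 := by
  classical
  have he : ∀ i, |signs ε θ i| < k := fun i => by rwa [abs_signs hε0]
  have hp := isProbabilityMeasure_hardProfile hk hn he
  have hr := isProbabilityMeasure_runLaw (m := m) (hardProfile n k (signs ε θ)) P
  set μ := runLaw m (hardProfile n k (signs ε θ)) P with hμ
  set B := misallocSet A (signs ε θ) with hB
  have hBm : ∀ i, MeasurableSet (B i) := measurableSet_misallocSet A hp
  have hBi : ∀ i, Integrable ((B i).indicator (fun _ => (1 : ℝ))) μ := fun i =>
    (integrable_const (1 : ℝ)).indicator (hBm i)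
  set N : (Fin m → Fin n → ℝ) × Ω → ℝ := fun q =>
    ∑ i ∈ Finset.univ.filter (fun i : Fin n => ¬ (i : ℕ) < k), (B i).indicator (fun _ => (1 : ℝ)) q with hN
  have hNi : Integrable N μ := integrable_finsetSum _ fun i _ => hBi i
  have hNm : Measurable N :=
    Finset.measurable_fun_sum _ fun i _ => measurable_const.indicator (hBm i)
  set G : Set ((Fin m → Fin n → ℝ) × Ω) := {q | N q ≤ 32 * c * n} with hG
  have hGm : MeasurableSet G := measurableSet_le hNm measurable_const
  have hGp : 0.99 ≤ μ.real G := by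
    -- The success event need not be measurable: it is only enclosed in the measurable set G, by
    -- monotonicity of the outer measure.
    refine hA.trans (measureReal_mono fun q hq => ?_)
    have := card_misallocates_le hk hn hε0 hε (abs_signs hε0 θ) hq.1 hq.2
    refine le_trans (le_of_eq ?_) this
    simp only [hN, Set.indicator_apply, Finset.sum_boole, Finset.filter_filter]
    rfl
  have hNle : ∀ q, N q ≤ 32 * c * n + Gᶜ.indicator (fun _ => (n : ℝ)) q := by
    intro q
    by_cases hq : q ∈ G
    · rw [Set.indicator_of_notMem fun h : q ∈ Gᶜ => h hq, add_zero]
      exact hq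
    · have h1 : N q ≤ n := by
        calc N q ≤ ∑ i ∈ Finset.univ.filter (fun i : Fin n => ¬ (i : ℕ) < k), (1 : ℝ) :=
              Finset.sum_le_sum fun i _ => Set.indicator_le_self' (by simp) q
          _ ≤ ∑ i : Fin n, (1 : ℝ) := Finset.sum_le_sum_of_subset_of_nonneg
              (Finset.filter_subset _ _) fun _ _ _ => zero_le_one
          _ = n := by simp
      have : 0 ≤ 32 * c * n := by positivity
      simpa [hq] using h1.trans (le_add_of_nonneg_left this)
  calc ∑ i ∈ Finset.univ.filter (fun i : Fin n => ¬ (i : ℕ) < k), μ.real (B i) = ∫ q, N q ∂μ := by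
        rw [hN, integral_finsetSum _ fun i _ => hBi i]
        exact Finset.sum_congr rfl fun i _ => (integral_indicator_one (hBm i)).symm
    _ ≤ ∫ q, (32 * c * n + Gᶜ.indicator (fun _ => (n : ℝ)) q) ∂μ :=
        integral_mono hNi ((integrable_const _).add ((integrable_const _).indicator hGm.compl)) hNle
    _ = 32 * c * n + (1 - μ.real G) * n := by
        rw [integral_add (integrable_const _) ((integrable_const _).indicator hGm.compl),
          integral_indicator_const _ hGm.compl, probReal_compl_eq_one_sub hGm]
        simp
    _ ≤ 32 * c * n + n / 100 := by
        have : (0 : ℝ) ≤ n := n.cast_nonneg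
        norm_num at hGp
        nlinarith

theorem card_nonbase (hkn : k ≤ n) :
    ((Finset.univ.filter fun i : Fin n => ¬ (i : ℕ) < k).card : ℝ) = n - k := by
  have h := Finset.card_filter_add_card_filter_not (s := (Finset.univ : Finset (Fin n)))
    (fun i : Fin n => (i : ℕ) < k)
  rw [Fin.card_filter_val_lt, min_eq_right hkn, Finset.card_univ, Fintype.card_fin] at h
  have h' : (k : ℝ) + ((Finset.univ.filter fun i : Fin n => ¬ (i : ℕ) < k).card : ℝ) = n := by
    exact_mod_cast h
  linarith

theorem not_forall_success (hk : 1 ≤ k) (hn : 2 * k ≤ n) {ε : ℝ} (hε0 : 0 < ε)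
    (hε : ε < k) (hm : m * (ε ^ 2 / (2 * n * k)) ≤ 1 / 1000) (A : LearningAlgorithm n k m Ω)
    (P : Measure Ω) [IsProbabilityMeasure P] :
    ¬ ∀ D ∈ hardFamily n k ε, 0.99 ≤ successProb A P D (1 / 640 * ε) := by
  intro hA
  have hk' : (1 : ℝ) ≤ k := by exact_mod_cast hk
  have hn' : 2 * (k : ℝ) ≤ n := by exact_mod_cast hn
  set p : (Fin n → Bool) → Fin n → ℝ := fun θ i =>
    (runLaw m (hardProfile n k (signs ε θ)) P).real (misallocSet A (signs ε θ) i) with hp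
  have hupper : ∀ θ, ∑ i ∈ Finset.univ.filter (fun i : Fin n => ¬ (i : ℕ) < k), p θ i ≤ 32 * (1 / 640) * n + n / 100 :=
    fun θ => sum_misallocSet_le hk hn (by norm_num) hε0 hε A P θ
      (hA _ (hardProfile_mem_hardFamily ε θ))
  set C : ℝ := ((Fintype.card (Fin n → Bool) : ℕ) : ℝ) with hC
  have hC0 : 0 < C := by
    rw [hC]; exact_mod_cast Fintype.card_pos
  have hlower : ∀ i : Fin n, ¬ (i : ℕ) < k → 9 / 20 * C ≤ ∑ θ, p θ i := by
    intro i hi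
    -- Flipping coordinate i permutes the sign vectors, so each bidder's average error is at least
    -- half of 9/10.
    have h1 : ∑ θ, p (flipAt i θ) i = ∑ θ, p θ i :=
      Equiv.sum_comp (flipAt_involutive i).toPerm fun θ => p θ i
    have h2 : C * (9 / 10) ≤ ∑ θ, (p θ i + p (flipAt i θ) i) := by
      rw [hC, ← nsmul_eq_mul, ← Finset.card_univ]
      exact Finset.card_nsmul_le_sum _ _ _ fun θ _ =>
        nine_tenths_le_flip_add hk hn hε0 hε hm A P θ hi
    rw [Finset.sum_add_distrib, h1] at h2
    linarith
  have hU : ∑ θ, ∑ i ∈ Finset.univ.filter (fun i : Fin n => ¬ (i : ℕ) < k), p θ i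
      ≤ C * (32 * (1 / 640) * n + n / 100) := by
    rw [hC, ← nsmul_eq_mul, ← Finset.card_univ]
    exact Finset.sum_le_card_nsmul _ _ _ fun θ _ => hupper θ
  have hL : (n - k) * (9 / 20 * C) ≤ ∑ θ, ∑ i ∈ Finset.univ.filter (fun i : Fin n => ¬ (i : ℕ) < k), p θ i := by
    rw [Finset.sum_comm, ← card_nonbase (by omega : k ≤ n), ← nsmul_eq_mul]
    exact Finset.card_nsmul_le_sum _ _ _ fun i hi => hlower i (Finset.mem_filter.1 hi).2
  -- Since n - k ≥ n/2, the average number of errors is at least 9n/40, against an upper bound of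
  -- n/20 + n/100.
  nlinarith [mul_pos hC0 (by linarith : (0 : ℝ) < n)]

end Assouad

/-! ### The sample complexity bound. -/

theorem mainTheorem6 :
    ∃ c₀ : ℝ, 0 < c₀ ∧ ∃ c₁ : ℝ, 0 < c₁ ∧
      ∀ (n k : ℕ), 1 ≤ k → 2 * k ≤ n →
      ∀ ε : ℝ, 0 < ε → ε < k →
      ∀ (m : ℕ) (Ω : Type*) [MeasurableSpace Ω] (P : Measure Ω) [IsProbabilityMeasure P]
        (A : LearningAlgorithm n k m Ω),
        (∀ D ∈ hardFamily n k ε, 0.99 ≤ successProb A P D (c₀ * ε)) →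
        c₁ * (n * k / ε ^ 2) ≤ m := by
  -- 1/640 makes 32c₀ = 1/20; with 1/500, a violation gives mε²/(2nk) < 1/1000, the testing
  -- threshold.
  refine ⟨1 / 640, by norm_num, 1 / 500, by norm_num, ?_⟩
  intro n k hk hn ε hε0 hε m Ω _ P _ A hA
  by_contra! hlt
  refine not_forall_success hk hn hε0 hε ?_ A P hA
  have hk' : (0 : ℝ) < k := by exact_mod_cast hk
  have hn' : (0 : ℝ) < n := by
    have : 0 < n := by omega
    exact_mod_cast this
  have h : (m : ℝ) * ε ^ 2 < 1 / 500 * (n * k) := by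
    rwa [← mul_div_assoc, lt_div_iff₀ (by positivity)] at hlt
  rw [← mul_div_assoc, div_le_iff₀ (by positivity)]
  linarith
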